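/- Let $n\ge 2$, $r_0>0$, $f(r)=r^2\bigl(1-(r_0/r)^n\bigr)$, and let $$g_{HM}=\frac{dr^2}{f(r)}+f(r)\,d\theta^2+r^2\sum_{A=3}^{n}(dx^A)^2,\qquad r>r_0,$$ be the Horowitz–Myers metric with parameter $r_0$ on $M=\mathbb R^2\times\mathbb T^{n-2}$, where $(r,\theta)$ are polar coordinates on $\mathbb R^2$ with $r=r_0$ at the origin, $\theta$ has period $\frac{4\pi}{nr_0}$, and the $x^A$ are periodic coordinates on the torus $\mathbb T^{n-2}$ with arbitrary periods $L_A>0$. Let $g$ be a smooth Riemannian metric on $M$ which for $r>r_0$ has the form $$g=e^{2u}dr^2+e^{2v}d\theta^2+e^{2w}\sum_{A=3}^{n}(dx^A)^2,$$ with $u,v,w$ smooth functions of $r\in(r_0,\infty)$ only. Here "smooth on $M$" means: for some smooth increasing function $\rho$ of $r$, with $\rho'>0$, $\rho\to0$ as $r\to r_0$ and $\rho\to\infty$ as $r\to\infty$, $g$ extends to a smooth metric in the Cartesian coordinates of $\mathbb R^2$ with polar radius $\rho$ and polar angle $\tfrac{nr_0}{2}\theta$. Assume that $g$ is asymptotic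 to $g_{HM}$, in the sense that the components of $g-g_{HM}$ in the $g_{HM}$-orthonormal frame proportional to $\partial_r,\partial_\theta,\partial_{x^A}$ are $o(r^{-n/2})$ as $r\to\infty$, and that $g$ has a well-defined mass relative to $g_{HM}$, that is, that with $V=r$, $\bar g=g_{HM}$ and $\bar\nabla$ the Levi-Civita connection of $\bar g$ the limit $$m=\lim_{s\to\infty}\int_{r=s}\Bigl[V g^{mj}g^{i\ell}\bigl(\bar\nabla_m g_{j\ell}-\bar\nabla_\ell g_{jm}\bigr)+\bigl(g^{mj}g^{ki}-g^{ij}g^{km}\bigr)(g_{jm}-\bar g_{jm})\bar\nabla_kV\Bigr]d\sigma_i,\qquad d\sigma_i=\sqrt{\det g}\;\partial_i\lrcorner(dr\wedge d\theta\wedge dx^3\wedge\cdots\wedge dx^n),$$ exists in $\mathbb R$. If the scalar curvature $R$ of $g$ satisfies $R\ge -n(n-1)$, then $$m\ge 0,$$ and $m=0$ if and only if $g$ coincides with the Horowitz–Myers metric with the same parameter $r_0$ up to the choice of the radial coordinate, that is, if and only if there is a smooth diffeomorphism $\psi$ of $(r_0,\infty)$ with $\psi'>0$ such that $g=\Psi^*g_{HM}$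 for $r>r_0$, where $\Psi(r,\theta,x)=(\psi(r),\theta,x)$. -/

import Mathlib

open Filter Topology MeasureTheory Asymptotics
open scoped ContDiff

noncomputable section

namespace HorowitzMyers

/-! Coordinate tensor calculus on open subsets of `ℝ^d`.  A metric is given by its matrix of
components, as a function of the coordinates. -/

/-- The partial derivative `∂_i F` at `q`. -/
def pd {d : ℕ} (i : Fin d) (F : (Fin d → ℝ) → ℝ) (q : Fin d → ℝ) : ℝ :=
  deriv (fun t => F (Function.update q i t)) (q i)

/-- The Christoffel symbols `Γ^a_{bc}` of the metric `g`. -/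
def christoffel {d : ℕ} (g : (Fin d → ℝ) → Matrix (Fin d) (Fin d) ℝ) (a b c : Fin d)
    (q : Fin d → ℝ) : ℝ :=
  (1 / 2) * ∑ e, (g q)⁻¹ a e *
    (pd b (fun p => g p e c) q + pd c (fun p => g p e b) q - pd e (fun p => g p b c) q)

/-- The Ricci tensor `R_{bc}` of the metric `g`. -/
def ricci {d : ℕ} (g : (Fin d → ℝ) → Matrix (Fin d) (Fin d) ℝ) (b c : Fin d)
    (q : Fin d → ℝ) : ℝ :=
  ∑ a, (pd a (christoffel g a b c) q - pd c (christoffel g a b a) q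
    + ∑ e, (christoffel g a a e q * christoffel g e b c q
      - christoffel g a c e q * christoffel g e b a q))

/-- The scalar curvature of the metric `g`. -/
def scalarCurvature {d : ℕ} (g : (Fin d → ℝ) → Matrix (Fin d) (Fin d) ℝ)
    (q : Fin d → ℝ) : ℝ :=
  ∑ b, ∑ c, (g q)⁻¹ b c * ricci g b c q

/-- The components `∇̄_m g_{jl}` of the covariant derivative of `g`, where `∇̄` is the Levi-Civita
connection of the background metric `gb`. -/
def covDeriv {d : ℕ} (gb g : (Fin d → ℝ) → Matrix (Fin d) (Fin d) ℝ) (m j l : Fin d)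
    (q : Fin d → ℝ) : ℝ :=
  pd m (fun p => g p j l) q
    - ∑ c, christoffel gb c m j q * g q c l - ∑ c, christoffel gb c m l q * g q j c

/-- The pull-back `Φ^* G` of the metric `G` by the map `Φ`. -/
def pullback {d : ℕ} (Φ : (Fin d → ℝ) → (Fin d → ℝ))
    (G : (Fin d → ℝ) → Matrix (Fin d) (Fin d) ℝ) (q : Fin d → ℝ) : Matrix (Fin d) (Fin d) ℝ :=
  Matrix.of fun i j =>
    ∑ a, ∑ b, pd i (fun p => Φ p a) q * pd j (fun p => Φ p b) q * G (Φ q) a b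

/-- The `i`-th component of the mass integrand of `g` relative to the background `gb` with static
potential `V`:
`V g^{mj} g^{il} (∇̄_m g_{jl} - ∇̄_l g_{jm})
  + (g^{mj} g^{ki} - g^{ij} g^{km}) (g_{jm} - gb_{jm}) ∂_k V`. -/
def massIntegrand {d : ℕ} (gb g : (Fin d → ℝ) → Matrix (Fin d) (Fin d) ℝ)
    (V : (Fin d → ℝ) → ℝ) (i : Fin d) (q : Fin d → ℝ) : ℝ :=
  ∑ m, ∑ j, ∑ l, V q * (g q)⁻¹ m j * (g q)⁻¹ i l *
      (covDeriv gb g m j l q - covDeriv gb g l j m q)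
  + ∑ m, ∑ j, ∑ k, ((g q)⁻¹ m j * (g q)⁻¹ k i - (g q)⁻¹ i j * (g q)⁻¹ k m) *
      (g q j m - gb q j m) * pd k V q

/-! Metrics on `ℝ² × 𝕋^k`, of dimension `n = k + 2`.  The coordinates are
`q = (r, θ, x^3, …, x^n)`: `r` is `q 0` and `θ` is `q 1`. -/

/-- The warped metric `e^{2u} dr² + e^{2v} dθ² + e^{2w} ∑ (dx^A)²`, with `u, v, w` functions
of `r`. -/
def warpedMetric (k : ℕ) (u v w : ℝ → ℝ) (q : Fin (k + 2) → ℝ) :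
    Matrix (Fin (k + 2)) (Fin (k + 2)) ℝ :=
  Matrix.diagonal fun i =>
    if i = 0 then Real.exp (2 * u (q 0))
    else if i = 1 then Real.exp (2 * v (q 0))
    else Real.exp (2 * w (q 0))

/-- `f(r) = r² (1 - (r₀ / r)^n)`, with `n = k + 2`. -/
def hmF (k : ℕ) (r₀ r : ℝ) : ℝ := r ^ 2 * (1 - (r₀ / r) ^ (k + 2))

/-- The Horowitz-Myers metric `dr² / f + f dθ² + r² ∑ (dx^A)²` with parameter `r₀`
(to be used on `r > r₀`). -/
def hmMetric (k : ℕ) (r₀ : ℝ) (q : Fin (k + 2) → ℝ) :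
    Matrix (Fin (k + 2)) (Fin (k + 2)) ℝ :=
  Matrix.diagonal fun i =>
    if i = 0 then 1 / hmF k r₀ (q 0)
    else if i = 1 then hmF k r₀ (q 0)
    else q 0 ^ 2

/-- The period `4 π / (n r₀)` of the angle `θ`. -/
def thetaPeriod (k : ℕ) (r₀ : ℝ) : ℝ := 4 * Real.pi / (((k + 2 : ℕ) : ℝ) * r₀)

/-- The map from the coordinates `(r, θ, x)` to the coordinates `(ρ cos φ, ρ sin φ, x)` of
`ℝ² × ℝ^k`, where `ρ = ρ(r)` and `φ = 2 π θ / (period of θ)` is `2 π`-periodic. -/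
def polarMap (k : ℕ) (r₀ : ℝ) (ρ : ℝ → ℝ) (q : Fin (k + 2) → ℝ) : Fin (k + 2) → ℝ := fun i =>
  if i = 0 then ρ (q 0) * Real.cos (2 * Real.pi * q 1 / thetaPeriod k r₀)
  else if i = 1 then ρ (q 0) * Real.sin (2 * Real.pi * q 1 / thetaPeriod k r₀)
  else q i

/-- `g`, given in the coordinates `(r, θ, x)` on `r > r₀`, is the expression of a smooth Riemannian
metric on all of `ℝ² × 𝕋^k` in polar coordinates of `ℝ²`, the core `{0} × 𝕋^k` being
at `r = r₀`.  The metric on `ℝ² × 𝕋^k` is represented by its lift `G` to `ℝ² × ℝ^k`; the polar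
radius `ρ` is any smooth increasing function of `r`, from `0` at `r₀` to infinity. -/
def IsSmoothMetricOnBulk (k : ℕ) (r₀ : ℝ)
    (g : (Fin (k + 2) → ℝ) → Matrix (Fin (k + 2)) (Fin (k + 2)) ℝ) : Prop :=
  ∃ (ρ : ℝ → ℝ) (G : (Fin (k + 2) → ℝ) → Matrix (Fin (k + 2)) (Fin (k + 2)) ℝ),
    ContDiffOn ℝ ∞ ρ (Set.Ioi r₀) ∧
    (∀ r, r₀ < r → 0 < ρ r ∧ 0 < deriv ρ r) ∧
    Tendsto ρ (𝓝[>] r₀) (𝓝 0) ∧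
    Tendsto ρ atTop atTop ∧
    (∀ i j, ContDiff ℝ ∞ fun p => G p i j) ∧
    (∀ p, (G p).PosDef) ∧
    ∀ q : Fin (k + 2) → ℝ, r₀ < q 0 → pullback (polarMap k r₀ ρ) G q = g q

/-- `g` is asymptotic to the Horowitz-Myers metric: the components of `g - g_HM` in the
`g_HM`-orthonormal frame `∂_i / |∂_i|` are `o(r^{-n/2})` for large `r`, uniformly in the
other coordinates. -/
def IsAsymptoticToHM (k : ℕ) (r₀ : ℝ)
    (g : (Fin (k + 2) → ℝ) → Matrix (Fin (k + 2)) (Fin (k + 2)) ℝ) : Prop :=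
  ∀ i j, (fun q : Fin (k + 2) → ℝ =>
      (g q i j - hmMetric k r₀ q i j) / Real.sqrt (hmMetric k r₀ q i i * hmMetric k r₀ q j j))
    =o[comap (fun q : Fin (k + 2) → ℝ => q 0) atTop]
      fun q => q 0 ^ (-(((k + 2 : ℕ) : ℝ) / 2))

/-- The flux of the mass integrand of `g`, relative to the Horowitz-Myers metric with static
potential `V = r`, through the torus `r = R`, on which `θ` runs over a period and `x^A` over
`[0, L A]`; the surface element is `dσ_i = √(det g) ∂_i ⌟ (dr ∧ dθ ∧ dx^3 ∧ … ∧ dx^n)`. -/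
def massFlux (k : ℕ) (r₀ : ℝ) (L : Fin k → ℝ)
    (g : (Fin (k + 2) → ℝ) → Matrix (Fin (k + 2)) (Fin (k + 2)) ℝ) (R : ℝ) : ℝ :=
  ∫ y in Set.Icc (0 : Fin (k + 1) → ℝ)
      (Fin.cons (α := fun _ : Fin (k + 1) => ℝ) (thetaPeriod k r₀) L),
    massIntegrand (hmMetric k r₀) g (fun q => q 0) 0
        (Fin.cons (α := fun _ : Fin (k + 2) => ℝ) R y) *
      Real.sqrt (g (Fin.cons (α := fun _ : Fin (k + 2) => ℝ) R y)).det

/-- The total mass of `g` relative to the Horowitz-Myers metric is well defined and equals `m`. -/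
def HasMass (k : ℕ) (r₀ : ℝ) (L : Fin k → ℝ)
    (g : (Fin (k + 2) → ℝ) → Matrix (Fin (k + 2)) (Fin (k + 2)) ℝ) (m : ℝ) : Prop :=
  Tendsto (massFlux k r₀ L g) atTop (𝓝 m)

/-- `g` coincides on `r > r₀` with the Horowitz-Myers metric with parameter `r₀`, up to the choice
of the radial coordinate: `g = Ψ^* g_HM` with `Ψ (r, θ, x) = (ψ r, θ, x)` and `ψ` a
diffeomorphism of `(r₀, ∞)`. -/
def CoincidesWithHM (k : ℕ) (r₀ : ℝ)
    (g : (Fin (k + 2) → ℝ) → Matrix (Fin (k + 2)) (Fin (k + 2)) ℝ) : Prop :=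
  ∃ ψ : ℝ → ℝ,
    ContDiffOn ℝ ∞ ψ (Set.Ioi r₀) ∧
    (∀ r, r₀ < r → 0 < deriv ψ r) ∧
    Set.BijOn ψ (Set.Ioi r₀) (Set.Ioi r₀) ∧
    ∀ q : Fin (k + 2) → ℝ, r₀ < q 0 →
      g q = pullback (fun p => Function.update p 0 (ψ (p 0))) (hmMetric k r₀) q

end HorowitzMyers

end

noncomputable section

namespace HorowitzMyers

/-! Write n = k + 2, let a prime be the arc-length derivative `radialDeriv u`, and put p = v', q =
w', H = p + kq, the mean curvature of the tori r = const. The bound on the scalar curvature becomes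
2H' ≤ n(n-1) - H² - p² - kq² (`radialDeriv_meanCurv_le`).

Each torus with H > k + 1 is compared with a torus in a Horowitz–Myers space having the same H and
the same θ-length. In the model with E = √f/r one has 2EH = n + kE²; this determines E < 1, then the
model radius c = e^v/E and the model parameter M = cⁿ(1 - E²), which is `comparisonMass`. Completing
the square in the curvature inequality gives M' ≤ -cⁿ E k(k+1)(E - q)² ≤ 0
(`hasDerivAt_comparisonMass`, `comparisonMass_bracket_le`), so M is nonincreasing.

At the core, the prescribed period of θ excludes a conical singularity, so e^v H tends to n r₀/2
(`tendsto_core`), which forces M ≤ r₀ⁿ (`comparisonMass_le`). At infinity M tends to r₀ⁿ - μ, where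
μ is the mass per unit coordinate volume (`tendsto_meanCurv_defect`, `tendsto_comparisonMass`).
Decay o(r^{-n/2}) suffices, without decay of derivatives: the linear terms in the metric
perturbation cancel, the quadratic ones are o(r^{-n}), and the derivatives of the metric enter the
mass only through H. Monotonicity then yields r₀ⁿ - μ ≤ M ≤ r₀ⁿ, hence μ ≥ 0.

The comparison needs H > k + 1 everywhere. If μ ≤ 0 this holds near infinity, since H - (k+1) has
there the sign of r₀ⁿ - μ, and the curvature inequality propagates it inwards (`lt_meanCurv`). If μ
> 0 there is nothing to prove for the inequality.

If μ = 0, then M is constant, so all the inequalities are equalities: q = E when k > 0, and c is the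
Horowitz–Myers radial coordinate (`coincidesWithHM_of_const`). Conversely a reparametrized model has
M = r₀ⁿ throughout, so its limit gives μ = 0 (`mass_of_coincides`). -/

/-! ### Curvature of diagonal metrics depending on one coordinate. -/

theorem pd_comp_zero {d : ℕ} (i : Fin (d + 1)) (F : ℝ → ℝ) (q : Fin (d + 1) → ℝ) :
    pd i (fun p => F (p 0)) q = if i = 0 then deriv F (q 0) else 0 := by
  unfold pd
  split_ifs with h
  · subst h; simp
  · simp [Function.update_of_ne (Ne.symm h)]

theorem pd_congr {d : ℕ} {r₀ : ℝ} (i : Fin (d + 1)) {F G : (Fin (d + 1) → ℝ) → ℝ}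
    (h : ∀ q, r₀ < q 0 → F q = G q) {q : Fin (d + 1) → ℝ} (hq : r₀ < q 0) :
    pd i F q = pd i G q := by
  unfold pd
  apply Filter.EventuallyEq.deriv_eq
  have hc : Continuous fun t : ℝ => (Function.update q i t) 0 :=
    (continuous_apply (0 : Fin (d + 1))).comp
      ((continuous_const (y := q)).update i continuous_id)
  have : ∀ᶠ t in 𝓝 (q i), r₀ < (Function.update q i t) 0 :=
    hc.continuousAt.eventually (lt_mem_nhds (by simpa using hq))
  filter_upwards [this] with t ht using h _ ht

/-- The diagonal metric with components depending on the zeroth coordinate only. -/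
def diagMetric {d : ℕ} (D : Fin (d + 1) → ℝ → ℝ) (q : Fin (d + 1) → ℝ) :
    Matrix (Fin (d + 1)) (Fin (d + 1)) ℝ :=
  Matrix.diagonal fun i => D i (q 0)

theorem diagMetric_inv {d : ℕ} {D : Fin (d + 1) → ℝ → ℝ} {q : Fin (d + 1) → ℝ}
    (hD : ∀ i, D i (q 0) ≠ 0) :
    (diagMetric D q)⁻¹ = Matrix.diagonal fun i => (D i (q 0))⁻¹ := by
  apply Matrix.inv_eq_right_inv
  rw [diagMetric, Matrix.diagonal_mul_diagonal, ← Matrix.diagonal_one]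
  congr 1
  ext i
  exact mul_inv_cancel₀ (hD i)

theorem pd_diagMetric {d : ℕ} (D : Fin (d + 1) → ℝ → ℝ) (i a b : Fin (d + 1))
    (q : Fin (d + 1) → ℝ) :
    pd i (fun p => diagMetric D p a b) q
      = if i = 0 ∧ a = b then deriv (D a) (q 0) else 0 := by
  by_cases h : a = b
  · subst h
    simp only [diagMetric, Matrix.diagonal_apply_eq, and_true]
    exact pd_comp_zero i (D a) q
  · simp [diagMetric, h, pd]

theorem christoffel_diagMetric {d : ℕ} {D : Fin (d + 1) → ℝ → ℝ} {q : Fin (d + 1) → ℝ}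
    (hD : ∀ i, D i (q 0) ≠ 0) (a b c : Fin (d + 1)) :
    christoffel (diagMetric D) a b c q = (1 / 2) * (D a (q 0))⁻¹ *
      ((if b = 0 ∧ a = c then deriv (D a) (q 0) else 0)
        + (if c = 0 ∧ a = b then deriv (D a) (q 0) else 0)
        - (if a = 0 ∧ b = c then deriv (D b) (q 0) else 0)) := by
  unfold christoffel
  rw [diagMetric_inv hD, Finset.sum_eq_single a]
  · simp only [Matrix.diagonal_apply_eq, pd_diagMetric]
    ring
  · intro e _ he
    rw [Matrix.diagonal_apply_ne _ (Ne.symm he), zero_mul]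
  · simp

/-- The exponents of the diagonal metric `warpedMetric`. -/
def warpExponent (k : ℕ) (u v w : ℝ → ℝ) (i : Fin (k + 2)) : ℝ → ℝ :=
  if i = 0 then u else if i = 1 then v else w

theorem warpedMetric_eq (k : ℕ) (u v w : ℝ → ℝ) :
    warpedMetric k u v w
      = diagMetric fun i r => Real.exp (2 * warpExponent k u v w i r) := by
  funext q
  unfold warpedMetric diagMetric warpExponent
  congr 1
  funext i
  dsimp only
  split_ifs <;> rfl

/-- The Christoffel symbols of the diagonal metric with components `e^{2 a_i}`, in terms
of the derivatives `b_i` of the `a_i`. -/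
def expChristoffel {d : ℕ} (A B : Fin (d + 1) → ℝ → ℝ) (a b c : Fin (d + 1)) (r : ℝ) : ℝ :=
  (if b = 0 ∧ a = c then B a r else 0) + (if c = 0 ∧ a = b then B a r else 0)
    - (if a = 0 ∧ b = c then Real.exp (2 * A b r - 2 * A 0 r) * B b r else 0)

theorem christoffel_exp {d : ℕ} {r₀ : ℝ} {A B : Fin (d + 1) → ℝ → ℝ}
    (hA : ∀ i r, r₀ < r → HasDerivAt (A i) (B i r) r)
    {q : Fin (d + 1) → ℝ} (hq : r₀ < q 0) (a b c : Fin (d + 1)) :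
    christoffel (diagMetric fun i r => Real.exp (2 * A i r)) a b c q
      = expChristoffel A B a b c (q 0) := by
  rw [christoffel_diagMetric (D := fun i r => Real.exp (2 * A i r))
    (fun i => (Real.exp_pos _).ne')]
  have hd : ∀ i, deriv (fun r => Real.exp (2 * A i r)) (q 0)
      = Real.exp (2 * A i (q 0)) * (2 * B i (q 0)) := fun i =>
    (((hA i _ hq).const_mul 2).exp).deriv
  simp only [hd, expChristoffel]
  have h2 : (Real.exp (2 * A a (q 0)))⁻¹ * Real.exp (2 * A a (q 0)) = 1 :=
    inv_mul_cancel₀ (Real.exp_pos _).ne'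
  have h3 : ∀ (P : Prop) [Decidable P], (1 / 2) * (Real.exp (2 * A a (q 0)))⁻¹ *
      (if P then Real.exp (2 * A a (q 0)) * (2 * B a (q 0)) else 0)
      = if P then B a (q 0) else 0 := by
    intro P _
    split_ifs
    · linear_combination B a (q 0) * h2
    · ring
  have h4 : (1 / 2) * (Real.exp (2 * A a (q 0)))⁻¹ *
      (if a = 0 ∧ b = c then Real.exp (2 * A b (q 0)) * (2 * B b (q 0)) else 0)
      = if a = 0 ∧ b = c then Real.exp (2 * A b (q 0) - 2 * A 0 (q 0)) * B b (q 0) else 0 := by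
    split_ifs with h
    · rw [h.1, Real.exp_sub]; ring
    · ring
  rw [mul_sub, mul_add, h3, h3, h4]

theorem expChristoffel_zero {d : ℕ} (A B : Fin (d + 1) → ℝ → ℝ) (a c : Fin (d + 1)) (r : ℝ) :
    expChristoffel A B a 0 c r = if a = c then B a r else 0 := by
  unfold expChristoffel
  by_cases ha : a = 0 <;> by_cases hc : c = 0 <;> simp_all [eq_comm]

theorem expChristoffel_self {d : ℕ} (A B : Fin (d + 1) → ℝ → ℝ) (a e : Fin (d + 1)) (r : ℝ) :
    expChristoffel A B a a e r = if e = 0 then B a r else 0 := by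
  unfold expChristoffel
  by_cases ha : a = 0 <;> by_cases hc : e = 0 <;> simp_all [eq_comm]

theorem expChristoffel_of_ne {d : ℕ} (A B : Fin (d + 1) → ℝ → ℝ) {b : Fin (d + 1)} (hb : b ≠ 0)
    (a c : Fin (d + 1)) (r : ℝ) :
    expChristoffel A B a b c r = (if c = 0 then (if a = b then B b r else 0) else 0)
      - (if a = 0 then (if c = b then Real.exp (2 * A b r - 2 * A 0 r) * B b r else 0) else 0) := by
  unfold expChristoffel
  by_cases ha : a = b <;> by_cases hc : c = 0 <;> simp_all [eq_comm, ← ite_and]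

theorem ricci_exp {d : ℕ} {r₀ : ℝ} {A B : Fin (d + 1) → ℝ → ℝ}
    (hA : ∀ i r, r₀ < r → HasDerivAt (A i) (B i r) r)
    {q : Fin (d + 1) → ℝ} (hq : r₀ < q 0) (b : Fin (d + 1)) :
    ricci (diagMetric fun i r => Real.exp (2 * A i r)) b b q
      = deriv (expChristoffel A B 0 b b) (q 0)
        - (if b = 0 then ∑ a, deriv (expChristoffel A B a b a) (q 0) else 0)
        + (∑ a, B a (q 0)) * expChristoffel A B 0 b b (q 0)
        - ∑ a, ∑ e, expChristoffel A B a b e (q 0) * expChristoffel A B e b a (q 0) := by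
  have hpd : ∀ i a b c, pd i (christoffel (diagMetric fun i r => Real.exp (2 * A i r)) a b c) q
      = if i = 0 then deriv (expChristoffel A B a b c) (q 0) else 0 := by
    intro i a b c
    rw [pd_congr i (G := fun p => expChristoffel A B a b c (p 0))
      (fun p hp => christoffel_exp hA hp a b c) hq, pd_comp_zero]
  unfold ricci
  simp only [hpd, christoffel_exp hA hq, expChristoffel_self, Finset.sum_add_distrib,
    Finset.sum_sub_distrib, ite_mul, zero_mul, Finset.sum_ite_eq', Finset.mem_univ, if_true,
    Finset.sum_mul]
  have : (∑ a, if b = 0 then deriv (expChristoffel A B a b a) (q 0) else 0)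
      = if b = 0 then ∑ a, deriv (expChristoffel A B a b a) (q 0) else 0 := by
    split_ifs <;> simp
  rw [this]
  ring

theorem ricci_exp_zero {d : ℕ} {r₀ : ℝ} {A B C : Fin (d + 1) → ℝ → ℝ}
    (hA : ∀ i r, r₀ < r → HasDerivAt (A i) (B i r) r)
    (hB : ∀ i r, r₀ < r → HasDerivAt (B i) (C i r) r)
    {q : Fin (d + 1) → ℝ} (hq : r₀ < q 0) :
    ricci (diagMetric fun i r => Real.exp (2 * A i r)) 0 0 q
      = C 0 (q 0) - ∑ a, C a (q 0) + (∑ a, B a (q 0)) * B 0 (q 0) - ∑ a, B a (q 0) ^ 2 := by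
  rw [ricci_exp hA hq]
  have h1 : ∀ a, expChristoffel A B a 0 a = B a := by
    intro a; funext r; simp [expChristoffel_zero]
  simp only [h1, (hB _ _ hq).deriv, if_true]
  congr 1
  refine Finset.sum_congr rfl fun a _ => ?_
  simp [expChristoffel_zero, sq]

theorem ricci_exp_of_ne {d : ℕ} {r₀ : ℝ} {A B C : Fin (d + 1) → ℝ → ℝ}
    (hA : ∀ i r, r₀ < r → HasDerivAt (A i) (B i r) r)
    (hB : ∀ i r, r₀ < r → HasDerivAt (B i) (C i r) r)
    {q : Fin (d + 1) → ℝ} (hq : r₀ < q 0) {b : Fin (d + 1)} (hb : b ≠ 0) :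
    ricci (diagMetric fun i r => Real.exp (2 * A i r)) b b q
      = Real.exp (2 * A b (q 0) - 2 * A 0 (q 0)) * (- C b (q 0) + 2 * B 0 (q 0) * B b (q 0)
          - (∑ a, B a (q 0)) * B b (q 0)) := by
  rw [ricci_exp hA hq]
  have h1 : expChristoffel A B 0 b b = fun r => - (Real.exp (2 * A b r - 2 * A 0 r) * B b r) := by
    funext r; simp [expChristoffel_of_ne A B hb, hb]
  have h2 := (((((hA b _ hq).const_mul 2).sub ((hA 0 _ hq).const_mul 2)).exp).mul
    (hB b _ hq)).neg
  have h3 : deriv (expChristoffel A B 0 b b) (q 0)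
      = -(Real.exp (2 * A b (q 0) - 2 * A 0 (q 0)) * (2 * B b (q 0) - 2 * B 0 (q 0)) * B b (q 0)
        + Real.exp (2 * A b (q 0) - 2 * A 0 (q 0)) * C b (q 0)) := by
    rw [h1]; exact h2.deriv
  rw [h3, h1]
  have h4 : (∑ a, ∑ e, expChristoffel A B a b e (q 0) * expChristoffel A B e b a (q 0))
      = - 2 * (Real.exp (2 * A b (q 0) - 2 * A 0 (q 0)) * B b (q 0)) * B b (q 0) := by
    simp only [expChristoffel_of_ne A B hb]
    -- For b ≠ 0 the only nonzero symbols in the product are Γ^b_{b0} = X and Γ^0_{bb} = -Y; the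
    -- mixed products survive at (a, e) = (b, 0) and (0, b), and the squares vanish because b ≠ 0.
    have : ∀ a e : Fin (d + 1), ∀ X Y : ℝ,
        ((if e = 0 then (if a = b then X else 0) else 0)
          - (if a = 0 then (if e = b then Y else 0) else 0)) *
        ((if a = 0 then (if e = b then X else 0) else 0)
          - (if e = 0 then (if a = b then Y else 0) else 0))
        = - (if e = 0 then (if a = b then X * Y else 0) else 0)
          - (if a = 0 then (if e = b then X * Y else 0) else 0) := by
      intro a e X Y
      by_cases ha : a = 0 <;> by_cases he : e = 0 <;> by_cases hab : a = b <;>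
        by_cases heb : e = b <;> simp_all <;> ring
    simp only [this, Finset.sum_sub_distrib, Finset.sum_neg_distrib, Finset.sum_ite_eq',
      Finset.mem_univ, if_true]
    simp
    ring
  rw [h4]
  simp only [hb, if_false]
  ring

theorem scalarCurvature_exp {d : ℕ} {r₀ : ℝ} {A B C : Fin (d + 1) → ℝ → ℝ}
    (hA : ∀ i r, r₀ < r → HasDerivAt (A i) (B i r) r)
    (hB : ∀ i r, r₀ < r → HasDerivAt (B i) (C i r) r)
    {q : Fin (d + 1) → ℝ} (hq : r₀ < q 0) :
    scalarCurvature (diagMetric fun i r => Real.exp (2 * A i r)) q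
      = Real.exp (-2 * A 0 (q 0)) * (-2 * ∑ i : Fin d, C i.succ (q 0)
        + 2 * B 0 (q 0) * (∑ i : Fin d, B i.succ (q 0))
        - (∑ i : Fin d, B i.succ (q 0)) ^ 2 - ∑ i : Fin d, B i.succ (q 0) ^ 2) := by
  unfold scalarCurvature
  rw [diagMetric_inv (D := fun i r => Real.exp (2 * A i r)) (fun i => (Real.exp_pos _).ne')]
  have h1 : ∀ b : Fin (d + 1), (∑ c, Matrix.diagonal (fun i => (Real.exp (2 * A i (q 0)))⁻¹) b c *
      ricci (diagMetric fun i r => Real.exp (2 * A i r)) b c q)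
      = (Real.exp (2 * A b (q 0)))⁻¹ *
        ricci (diagMetric fun i r => Real.exp (2 * A i r)) b b q := by
    intro b
    rw [Finset.sum_eq_single b]
    · rw [Matrix.diagonal_apply_eq]
    · intro c _ hc
      rw [Matrix.diagonal_apply_ne _ (Ne.symm hc), zero_mul]
    · simp
  simp only [h1]
  rw [Fin.sum_univ_succ, ricci_exp_zero hA hB hq]
  have h2 : ∀ i : Fin d, (Real.exp (2 * A i.succ (q 0)))⁻¹ *
        ricci (diagMetric fun i r => Real.exp (2 * A i r)) i.succ i.succ q
      = Real.exp (-2 * A 0 (q 0)) * (- C i.succ (q 0) + 2 * B 0 (q 0) * B i.succ (q 0)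
          - (∑ a, B a (q 0)) * B i.succ (q 0)) := by
    intro i
    rw [ricci_exp_of_ne hA hB hq (Fin.succ_ne_zero i), ← mul_assoc, ← Real.exp_neg,
      ← Real.exp_add]
    ring_nf
  simp only [h2, ← Finset.mul_sum, Finset.sum_add_distrib, Finset.sum_sub_distrib,
    Finset.sum_neg_distrib, Fin.sum_univ_succ (n := d)]
  rw [← Real.exp_neg, ← neg_mul]
  ring

/-! ### Scalar curvature in terms of the mean curvature of the tori. -/

/-- The derivative with respect to arc length of the radial curves of `warpedMetric`. -/
def radialDeriv (u F : ℝ → ℝ) (r : ℝ) : ℝ := Real.exp (-u r) * deriv F r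

/-- The mean curvature of the tori `r = const`. -/
def meanCurv (k : ℕ) (u v w : ℝ → ℝ) (r : ℝ) : ℝ :=
  radialDeriv u v r + k * radialDeriv u w r

theorem hasDerivAt_of_contDiffOn {r₀ : ℝ} {F : ℝ → ℝ} (hF : ContDiffOn ℝ ∞ F (Set.Ioi r₀))
    {r : ℝ} (hr : r₀ < r) : HasDerivAt F (deriv F r) r :=
  ((hF.differentiableOn (by simp)).differentiableAt (Ioi_mem_nhds hr)).hasDerivAt

theorem contDiffOn_deriv_Ioi {r₀ : ℝ} {F : ℝ → ℝ} (hF : ContDiffOn ℝ ∞ F (Set.Ioi r₀)) :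
    ContDiffOn ℝ ∞ (deriv F) (Set.Ioi r₀) :=
  hF.deriv_of_isOpen isOpen_Ioi (by simp)

theorem hasDerivAt_meanCurv {k : ℕ} {r₀ : ℝ} {u v w : ℝ → ℝ}
    (hu : ContDiffOn ℝ ∞ u (Set.Ioi r₀)) (hv : ContDiffOn ℝ ∞ v (Set.Ioi r₀))
    (hw : ContDiffOn ℝ ∞ w (Set.Ioi r₀)) {r : ℝ} (hr : r₀ < r) :
    HasDerivAt (meanCurv k u v w)
      (Real.exp (-u r) * (deriv (deriv v) r + k * deriv (deriv w) r
        - deriv u r * (deriv v r + k * deriv w r))) r := by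
  have h1 := (hasDerivAt_of_contDiffOn hu hr).neg.exp
  have h2 := hasDerivAt_of_contDiffOn (contDiffOn_deriv_Ioi hv) hr
  have h3 := hasDerivAt_of_contDiffOn (contDiffOn_deriv_Ioi hw) hr
  refine ((h1.mul h2).add ((h1.mul h3).const_mul (k : ℝ))).congr_deriv ?_
  simp only [Pi.neg_apply]
  ring

theorem scalarCurvature_warpedMetric {k : ℕ} {r₀ : ℝ} {u v w : ℝ → ℝ}
    (hu : ContDiffOn ℝ ∞ u (Set.Ioi r₀)) (hv : ContDiffOn ℝ ∞ v (Set.Ioi r₀))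
    (hw : ContDiffOn ℝ ∞ w (Set.Ioi r₀)) {q : Fin (k + 2) → ℝ} (hq : r₀ < q 0) :
    scalarCurvature (warpedMetric k u v w) q
      = -2 * radialDeriv u (meanCurv k u v w) (q 0) - meanCurv k u v w (q 0) ^ 2
        - radialDeriv u v (q 0) ^ 2 - k * radialDeriv u w (q 0) ^ 2 := by
  have hs : ∀ i : Fin (k + 2), ContDiffOn ℝ ∞ (warpExponent k u v w i) (Set.Ioi r₀) := by
    intro i; unfold warpExponent; split_ifs <;> assumption
  rw [warpedMetric_eq, scalarCurvature_exp
    (A := warpExponent k u v w) (B := fun i => deriv (warpExponent k u v w i))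
    (C := fun i => deriv (deriv (warpExponent k u v w i)))
    (fun i r hr => hasDerivAt_of_contDiffOn (hs i) hr)
    (fun i r hr => hasDerivAt_of_contDiffOn (contDiffOn_deriv_Ioi (hs i)) hr) hq]
  have e0 : warpExponent k u v w 0 = u := by simp [warpExponent]
  have e1 : warpExponent k u v w 1 = v := by simp [warpExponent]
  have e2 : ∀ i : Fin k, warpExponent k u v w i.succ.succ = w := by
    intro i
    have : i.succ.succ ≠ 1 := fun h => Fin.succ_ne_zero i (Fin.succ_injective _ h)
    simp [warpExponent, this]
  simp only [Fin.sum_univ_succ (n := k), e0, e2, Fin.succ_zero_eq_one, e1, Finset.sum_const,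
    Finset.card_univ, Fintype.card_fin, nsmul_eq_mul]
  unfold meanCurv
  rw [show radialDeriv u (fun r => radialDeriv u v r + k * radialDeriv u w r) (q 0)
    = _ from congrArg (Real.exp (-u (q 0)) * ·) (hasDerivAt_meanCurv hu hv hw hq).deriv]
  have h : Real.exp (-2 * u (q 0)) = Real.exp (-u (q 0)) ^ 2 := by
    rw [← Real.exp_nat_mul]; ring_nf
  rw [h]
  unfold radialDeriv
  ring

/-! ### The mass integrand of a warped metric. -/

theorem covDeriv_diagMetric {d : ℕ} (D Db : Fin (d + 1) → ℝ → ℝ) (m j l : Fin (d + 1))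
    (q : Fin (d + 1) → ℝ) :
    covDeriv (diagMetric Db) (diagMetric D) m j l q
      = (if m = 0 ∧ j = l then deriv (D j) (q 0) else 0)
        - christoffel (diagMetric Db) l m j q * D l (q 0)
        - christoffel (diagMetric Db) j m l q * D j (q 0) := by
  unfold covDeriv
  rw [pd_diagMetric]
  congr 1
  · congr 1
    rw [Finset.sum_eq_single l]
    · simp [diagMetric]
    · intro c _ hc; simp [diagMetric, hc]
    · simp
  · rw [Finset.sum_eq_single j]
    · simp [diagMetric]
    · intro c _ hc; simp [diagMetric, Ne.symm hc]
    · simp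

/-- Only tangential directions contribute: for m = 0 the two covariant derivatives coincide and the
two algebraic terms cancel. The radial background component enters through Γ^0_{ii}. -/
theorem massIntegrand_diagMetric {d : ℕ} {D Db : Fin (d + 1) → ℝ → ℝ} {q : Fin (d + 1) → ℝ}
    (hD : ∀ i, D i (q 0) ≠ 0) (hDb : ∀ i, Db i (q 0) ≠ 0) :
    massIntegrand (diagMetric Db) (diagMetric D) (fun p => p 0) 0 q
      = ∑ i : Fin d, (D i.succ (q 0))⁻¹ * (D 0 (q 0))⁻¹ *
        (q 0 * ((1 / 2) * (Db 0 (q 0))⁻¹ * deriv (Db i.succ) (q 0) * D 0 (q 0)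
          + (1 / 2) * (Db i.succ (q 0))⁻¹ * deriv (Db i.succ) (q 0) * D i.succ (q 0)
          - deriv (D i.succ) (q 0)) + (D i.succ (q 0) - Db i.succ (q 0))) := by
  unfold massIntegrand
  rw [diagMetric_inv hD]
  have hpd : ∀ k : Fin (d + 1), pd k (fun p : Fin (d + 1) → ℝ => p 0) q
      = if k = 0 then 1 else 0 := by
    intro k
    rw [pd_comp_zero k (fun x => x) q]; simp
  have h1 : (∑ m, ∑ j, ∑ l, q 0 * Matrix.diagonal (fun i => (D i (q 0))⁻¹) m j *
      Matrix.diagonal (fun i => (D i (q 0))⁻¹) 0 l *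
      (covDeriv (diagMetric Db) (diagMetric D) m j l q
        - covDeriv (diagMetric Db) (diagMetric D) l j m q))
      = ∑ m, q 0 * (D m (q 0))⁻¹ * (D 0 (q 0))⁻¹ *
        (covDeriv (diagMetric Db) (diagMetric D) m m 0 q
          - covDeriv (diagMetric Db) (diagMetric D) 0 m m q) := by
    refine Finset.sum_congr rfl fun m _ => ?_
    rw [Finset.sum_eq_single m]
    · rw [Finset.sum_eq_single 0]
      · simp
      · intro l _ hl; simp [Matrix.diagonal_apply_ne _ (Ne.symm hl)]
      · simp
    · intro j _ hj; simp [Matrix.diagonal_apply_ne _ (Ne.symm hj)]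
    · simp
  have h2 : (∑ m, ∑ j, ∑ k, (Matrix.diagonal (fun i => (D i (q 0))⁻¹) m j *
      Matrix.diagonal (fun i => (D i (q 0))⁻¹) k 0
        - Matrix.diagonal (fun i => (D i (q 0))⁻¹) 0 j *
          Matrix.diagonal (fun i => (D i (q 0))⁻¹) k m) *
      (diagMetric D q j m - diagMetric Db q j m) * pd k (fun p : Fin (d + 1) → ℝ => p 0) q)
      = ∑ m, ((D m (q 0))⁻¹ * (D 0 (q 0))⁻¹ * (D m (q 0) - Db m (q 0))
        - if m = 0 then (D 0 (q 0))⁻¹ * (D 0 (q 0))⁻¹ * (D 0 (q 0) - Db 0 (q 0)) else 0) := by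
    refine Finset.sum_congr rfl fun m _ => ?_
    rw [Finset.sum_eq_single m]
    · rw [Finset.sum_eq_single 0]
      · by_cases hm : m = 0
        · subst hm; simp [hpd, diagMetric]
        · simp [hpd, diagMetric, hm, Ne.symm hm]
      · intro l _ hl; simp [hpd, hl]
      · simp
    · intro j _ hj; simp [diagMetric, hj]
    · simp
  rw [h1, h2, ← Finset.sum_add_distrib, Fin.sum_univ_succ]
  simp only [covDeriv_diagMetric, christoffel_diagMetric hDb, Fin.succ_ne_zero, if_true, if_false,
    and_self, (Fin.succ_ne_zero _).symm]
  ring_nf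

/-- The components of the Horowitz-Myers metric. -/
def hmComponent (k : ℕ) (r₀ : ℝ) (i : Fin (k + 2)) : ℝ → ℝ :=
  if i = 0 then fun r => 1 / hmF k r₀ r else if i = 1 then hmF k r₀ else fun r => r ^ 2

theorem hmMetric_eq (k : ℕ) (r₀ : ℝ) : hmMetric k r₀ = diagMetric (hmComponent k r₀) := by
  funext q
  unfold hmMetric diagMetric hmComponent
  congr 1
  funext i
  split_ifs <;> rfl

theorem pow_ratio_lt_one {k : ℕ} {r₀ r : ℝ} (hr₀ : 0 < r₀) (hr : r₀ < r) :
    (r₀ / r) ^ (k + 2) < 1 :=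
  pow_lt_one₀ (div_pos hr₀ (hr₀.trans hr)).le ((div_lt_one (hr₀.trans hr)).2 hr) (by simp)

theorem hmF_pos {k : ℕ} {r₀ r : ℝ} (hr₀ : 0 < r₀) (hr : r₀ < r) : 0 < hmF k r₀ r :=
  mul_pos (pow_pos (hr₀.trans hr) 2) (sub_pos.2 (pow_ratio_lt_one hr₀ hr))

theorem hasDerivAt_hmF (k : ℕ) (r₀ : ℝ) {r : ℝ} (hr : 0 < r) :
    HasDerivAt (hmF k r₀)
      (2 * r * (1 - (r₀ / r) ^ (k + 2)) + (k + 2) * r * (r₀ / r) ^ (k + 2)) r := by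
  have h1 : HasDerivAt (fun x : ℝ => r₀ / x) (-r₀ / r ^ 2) r := by
    refine ((hasDerivAt_inv hr.ne').const_mul r₀).congr_deriv ?_
    ring
  have h2 := (hasDerivAt_pow 2 r).mul ((h1.pow (k + 2)).const_sub 1)
  refine h2.congr_deriv ?_
  have : r ≠ 0 := hr.ne'
  simp only [Pi.pow_apply]
  push_cast
  rw [pow_succ _ (k + 1)]
  generalize (r₀ / r) ^ (k + 1) = y
  field_simp

theorem hmComponent_pos {k : ℕ} {r₀ r : ℝ} (hr₀ : 0 < r₀) (hr : r₀ < r) (i : Fin (k + 2)) :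
    0 < hmComponent k r₀ i r := by
  have := hmF_pos (k := k) hr₀ hr
  have h := hr₀.trans hr
  unfold hmComponent
  split_ifs <;> positivity

/-- The volume density of the tori `r = const`. -/
def torusDensity (k : ℕ) (v w : ℝ → ℝ) (r : ℝ) : ℝ := Real.exp (v r + k * w r)

/-- The flux of the mass integrand through the torus `r = const` per unit coordinate volume. -/
def massDensity (k : ℕ) (r₀ : ℝ) (u v w : ℝ → ℝ) (r : ℝ) : ℝ :=
  torusDensity k v w r * (Real.exp (-u r) *
    (r * ((1 / 2) * hmF k r₀ r * deriv (hmF k r₀) r * Real.exp (2 * u r - 2 * v r)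
        + (1 / 2) * (hmF k r₀ r)⁻¹ * deriv (hmF k r₀) r)
      + 1 - hmF k r₀ r * Real.exp (-2 * v r)
      + k * (r ^ 2 * hmF k r₀ r * Real.exp (2 * u r - 2 * w r) + 2
        - r ^ 2 * Real.exp (-2 * w r))) - 2 * r * meanCurv k u v w r)

theorem warpedMetric_det (k : ℕ) (u v w : ℝ → ℝ) (q : Fin (k + 2) → ℝ) :
    Real.sqrt (warpedMetric k u v w q).det
      = Real.exp (u (q 0)) * torusDensity k v w (q 0) := by
  have e2 : ∀ i : Fin k, i.succ.succ ≠ 1 := by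
    intro i h; exact Fin.succ_ne_zero i (Fin.succ_injective _ h)
  have : (warpedMetric k u v w q).det = (Real.exp (u (q 0)) * torusDensity k v w (q 0)) ^ 2 := by
    unfold warpedMetric torusDensity
    rw [Matrix.det_diagonal]
    simp only [Fin.prod_univ_succ (n := k + 1), Fin.prod_univ_succ (n := k), if_true,
      Fin.succ_ne_zero, if_false, Fin.succ_zero_eq_one, e2, Finset.prod_const, Finset.card_univ,
      Fintype.card_fin]
    rw [← Real.exp_nat_mul, ← Real.exp_add, ← Real.exp_add, ← Real.exp_add, ← Real.exp_nat_mul]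
    congr 1
    push_cast
    ring
  rw [this, Real.sqrt_sq]
  unfold torusDensity
  positivity

theorem massIntegrand_warpedMetric {k : ℕ} {r₀ : ℝ} (hr₀ : 0 < r₀) {u v w : ℝ → ℝ}
    (hv : ContDiffOn ℝ ∞ v (Set.Ioi r₀)) (hw : ContDiffOn ℝ ∞ w (Set.Ioi r₀))
    {q : Fin (k + 2) → ℝ} (hq : r₀ < q 0) :
    massIntegrand (hmMetric k r₀) (warpedMetric k u v w) (fun p => p 0) 0 q *
      Real.sqrt (warpedMetric k u v w q).det = massDensity k r₀ u v w (q 0) := by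
  have e2 : ∀ i : Fin k, i.succ.succ ≠ 1 := by
    intro i h; exact Fin.succ_ne_zero i (Fin.succ_injective _ h)
  have w0 : warpExponent k u v w 0 = u := by simp [warpExponent]
  have w1 : warpExponent k u v w (Fin.succ 0) = v := by simp [warpExponent]
  have w2 : ∀ i : Fin k, warpExponent k u v w i.succ.succ = w := fun i => by
    simp [warpExponent, e2]
  have f0 : hmComponent k r₀ 0 = fun r => 1 / hmF k r₀ r := by simp [hmComponent]
  have f1 : hmComponent k r₀ (Fin.succ 0) = hmF k r₀ := by simp [hmComponent]
  have f2 : ∀ i : Fin k, hmComponent k r₀ i.succ.succ = fun r => r ^ 2 := fun i => by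
    simp [hmComponent, e2]
  rw [warpedMetric_det, warpedMetric_eq, hmMetric_eq, massIntegrand_diagMetric
    (D := fun i r => Real.exp (2 * warpExponent k u v w i r)) (fun i => (Real.exp_pos _).ne')
    (fun i => (hmComponent_pos hr₀ hq i).ne')]
  have hF := hmF_pos (k := k) hr₀ hq
  have hr : 0 < q 0 := hr₀.trans hq
  have hdv : deriv (fun r => Real.exp (2 * v r)) (q 0) = Real.exp (2 * v (q 0)) *
      (2 * deriv v (q 0)) := ((hasDerivAt_of_contDiffOn hv hq).const_mul 2).exp.deriv
  have hdw : deriv (fun r => Real.exp (2 * w r)) (q 0) = Real.exp (2 * w (q 0)) *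
      (2 * deriv w (q 0)) := ((hasDerivAt_of_contDiffOn hw hq).const_mul 2).exp.deriv
  have hd2 : deriv (fun r : ℝ => r ^ 2) (q 0) = 2 * q 0 := by simp
  simp only [Fin.sum_univ_succ (n := k), w0, w1, w2, f0, f1, f2, Finset.sum_const,
    Finset.card_univ, Fintype.card_fin, nsmul_eq_mul, hdv, hdw, hd2]
  unfold massDensity meanCurv radialDeriv
  have s1 : Real.exp (2 * u (q 0) - 2 * v (q 0))
    = Real.exp (u (q 0)) ^ 2 / Real.exp (v (q 0)) ^ 2 := by
    rw [← Real.exp_nat_mul, ← Real.exp_nat_mul, ← Real.exp_sub]; rfl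
  have s2 : Real.exp (2 * u (q 0) - 2 * w (q 0))
    = Real.exp (u (q 0)) ^ 2 / Real.exp (w (q 0)) ^ 2 := by
    rw [← Real.exp_nat_mul, ← Real.exp_nat_mul, ← Real.exp_sub]; rfl
  have s3 : ∀ t : ℝ, Real.exp (2 * t) = Real.exp t ^ 2 := fun t => by
    rw [← Real.exp_nat_mul]; rfl
  have s4 : ∀ t : ℝ, Real.exp (-2 * t) = (Real.exp t ^ 2)⁻¹ := fun t => by
    rw [← Real.exp_nat_mul, ← Real.exp_neg, ← neg_mul]; rfl
  rw [s1, s2]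
  simp only [s3, s4, Real.exp_neg]
  have a1 := Real.exp_pos (u (q 0))
  have a2 := Real.exp_pos (v (q 0))
  have a3 := Real.exp_pos (w (q 0))
  field_simp
  ring

/-- The integrand is constant on each torus, so the flux is the density times the coordinate volume
c of the period box. Since c > 0 does not depend on the metric or on R, mass and density limit have
the same sign and vanish together. -/
theorem massFlux_warpedMetric {k : ℕ} {r₀ : ℝ} (hr₀ : 0 < r₀) {L : Fin k → ℝ}
    (hL : ∀ A, 0 < L A) :
    ∃ c : ℝ, 0 < c ∧ ∀ u v w : ℝ → ℝ, ContDiffOn ℝ ∞ v (Set.Ioi r₀) →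
      ContDiffOn ℝ ∞ w (Set.Ioi r₀) → ∀ R, r₀ < R →
      massFlux k r₀ L (warpedMetric k u v w) R = c * massDensity k r₀ u v w R := by
  set b : Fin (k + 1) → ℝ := Fin.cons (α := fun _ : Fin (k + 1) => ℝ) (thetaPeriod k r₀) L with hb
  have hbpos : ∀ i, 0 < b i := by
    intro i
    refine Fin.cases ?_ (fun j => ?_) i
    · simp only [hb, Fin.cons_zero, thetaPeriod]; have := Real.pi_pos; positivity
    · simpa [hb] using hL j
  refine ⟨volume.real (Set.Icc (0 : Fin (k + 1) → ℝ) b), ?_, ?_⟩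
  · have h0 : (0 : Fin (k + 1) → ℝ) ≤ b := fun i => (hbpos i).le
    rw [Measure.real, Real.volume_Icc_pi_toReal h0]
    exact Finset.prod_pos fun i _ => by simpa using hbpos i
  · intro u v w hv hw R hR
    unfold massFlux
    have : ∀ y : Fin (k + 1) → ℝ, massIntegrand (hmMetric k r₀) (warpedMetric k u v w)
        (fun q => q 0) 0 (Fin.cons (α := fun _ : Fin (k + 2) => ℝ) R y) *
        Real.sqrt (warpedMetric k u v w (Fin.cons (α := fun _ : Fin (k + 2) => ℝ) R y)).det
        = massDensity k r₀ u v w R := fun y =>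
      massIntegrand_warpedMetric hr₀ hv hw
        (q := Fin.cons (α := fun _ : Fin (k + 2) => ℝ) R y) hR
    simp only [this]
    rw [setIntegral_const, smul_eq_mul]

/-! ### Asymptotics of the mass density. -/

/-- `F` tends to one faster than `r^{-(k+2)/2}`. -/
def IsFastToOne (k : ℕ) (F : ℝ → ℝ) : Prop :=
  Tendsto (fun r : ℝ => r ^ (((k + 2 : ℕ) : ℝ) / 2) * (F r - 1)) atTop (𝓝 0)

theorem IsFastToOne.tendsto {k : ℕ} {F : ℝ → ℝ} (h : IsFastToOne k F) :
    Tendsto F atTop (𝓝 1) := by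
  have h1 : Tendsto (fun r : ℝ => (r ^ (((k + 2 : ℕ) : ℝ) / 2))⁻¹) atTop (𝓝 0) :=
    (tendsto_rpow_atTop (by positivity)).inv_tendsto_atTop
  have h2 := (h1.mul h).add_const 1
  simp only [zero_mul, zero_add] at h2
  refine h2.congr' ?_
  filter_upwards [eventually_gt_atTop 0] with r hr
  have : r ^ (((k + 2 : ℕ) : ℝ) / 2) ≠ 0 := (Real.rpow_pos_of_pos hr _).ne'
  field_simp
  ring

theorem rpow_half_sq (k : ℕ) {r : ℝ} (hr : 0 < r) :
    (r ^ (((k + 2 : ℕ) : ℝ) / 2)) ^ 2 = r ^ (k + 2) := by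
  rw [← Real.rpow_natCast, ← Real.rpow_mul hr.le, ← Real.rpow_natCast r (k + 2)]
  congr 1
  push_cast
  ring

theorem IsAsymptoticToHM.isFastToOne {k : ℕ} {r₀ : ℝ} (hr₀ : 0 < r₀) {u v w : ℝ → ℝ}
    (h : IsAsymptoticToHM k r₀ (warpedMetric k u v w)) (i : Fin (k + 2)) :
    IsFastToOne k fun r => Real.exp (2 * warpExponent k u v w i r) / hmComponent k r₀ i r := by
  have ht : Tendsto (fun (r : ℝ) (_ : Fin (k + 2)) => r) atTop
      (comap (fun q : Fin (k + 2) → ℝ => q 0) atTop) :=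
    tendsto_comap_iff.2 tendsto_id
  have h1 := ((h i i).comp_tendsto ht).tendsto_div_nhds_zero
  unfold IsFastToOne
  refine h1.congr' ?_
  filter_upwards [eventually_gt_atTop r₀] with r hr
  have hc := hmComponent_pos (k := k) hr₀ hr i
  simp only [Function.comp_apply, warpedMetric_eq, hmMetric_eq, diagMetric,
    Matrix.diagonal_apply_eq]
  rw [Real.sqrt_mul_self hc.le, Real.rpow_neg (hr₀.trans hr).le, div_inv_eq_mul, mul_comm,
    sub_div, div_self hc.ne']

theorem tendsto_pow_ratio (k : ℕ) (r₀ : ℝ) :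
    Tendsto (fun r : ℝ => (r₀ / r) ^ (k + 2)) atTop (𝓝 0) := by
  have h := ((tendsto_const_nhds (x := r₀)).div_atTop (tendsto_id (α := ℝ))).pow (k + 2)
  simpa using h

theorem tendsto_sqrt_one_sub (k : ℕ) (r₀ : ℝ) :
    Tendsto (fun r : ℝ => Real.sqrt (1 - (r₀ / r) ^ (k + 2))) atTop (𝓝 1) := by
  simpa using ((tendsto_pow_ratio k r₀).const_sub 1).sqrt

/-- The expression vanishes to second order at x = y = 1, and any product of two fast factors is
o(r^{-(k+2)}). -/
theorem tendsto_pow_mul_cross {k : ℕ} {x y : ℝ → ℝ} (hx : IsFastToOne k x)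
    (hy : IsFastToOne k y) :
    Tendsto (fun r => r ^ (k + 2) * ((2 + (x r - 1) / y r) / Real.sqrt (x r) - 2))
      atTop (𝓝 0) := by
  have hsx : Tendsto (fun r => Real.sqrt (x r)) atTop (𝓝 1) := by simpa using hx.tendsto.sqrt
  -- The exact form is ((√x - 1)² - (x - 1)(y - 1)/y)/√x, with √x - 1 = (x - 1)/(√x + 1).
  have hmain : Tendsto (fun r => (((r ^ (((k + 2 : ℕ) : ℝ) / 2) * (x r - 1)) ^ 2 /
      (Real.sqrt (x r) + 1) ^ 2) - (r ^ (((k + 2 : ℕ) : ℝ) / 2) * (x r - 1)) *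
        (r ^ (((k + 2 : ℕ) : ℝ) / 2) * (y r - 1)) / y r) / Real.sqrt (x r)) atTop
      (𝓝 ((0 ^ 2 / (1 + 1) ^ 2 - 0 * 0 / 1) / 1)) :=
    ((((Tendsto.pow hx 2).div ((hsx.add_const 1).pow 2) (by norm_num)).sub
      ((Tendsto.mul hx hy).div hy.tendsto one_ne_zero)).div hsx one_ne_zero)
  rw [show ((0 ^ 2 / (1 + 1) ^ 2 - 0 * 0 / 1) / 1 : ℝ) = 0 by norm_num] at hmain
  refine hmain.congr' ?_
  filter_upwards [eventually_gt_atTop 0, hx.tendsto.eventually (lt_mem_nhds one_pos),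
    hy.tendsto.eventually (lt_mem_nhds one_pos)] with r hr hxr hyr
  rw [← rpow_half_sq k hr]
  generalize r ^ (((k + 2 : ℕ) : ℝ) / 2) = t
  have hs := Real.sqrt_pos.2 hxr
  have hxs := Real.sq_sqrt hxr.le
  generalize Real.sqrt (x r) = s at hs hxs
  rw [← hxs]
  field_simp
  ring

/-- The variables x, y, z are the ratios of the metric components to those of the model. Their
deviation from 1 contributes nothing in the limit, which is therefore that of the model itself. -/
theorem tendsto_massBracket {k : ℕ} {r₀ : ℝ} (hr₀ : 0 < r₀) {x y z : ℝ → ℝ}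
    (hx : IsFastToOne k x) (hy : IsFastToOne k y) (hz : IsFastToOne k z) :
    Tendsto (fun r => r ^ (k + 2) * (Real.sqrt (1 - (r₀ / r) ^ (k + 2)) / Real.sqrt (x r) *
      ((1 + ((k : ℝ) + 2) / 2 * (r₀ / r) ^ (k + 2) / (1 - (r₀ / r) ^ (k + 2))) * (1 + x r / y r)
        + 1 - 1 / y r + k * (x r / z r + 2 - 1 / z r)) - 2 * (k + 1))) atTop
      (𝓝 (r₀ ^ (k + 2))) := by
  have hsx : Tendsto (fun r => Real.sqrt (x r)) atTop (𝓝 1) := by simpa using hx.tendsto.sqrt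
  have hS := tendsto_sqrt_one_sub k r₀
  have hX := (tendsto_pow_ratio k r₀).const_sub 1
  rw [sub_zero] at hX
  -- With X = (r₀/r)^(k+2) and S = √(1 - X) there are three pieces: the quadratic remainders,
  -- tending to 0; the loss 2(k+1)(1 - S) with 1 - S = X/(1 + S), contributing -(k+1)r₀^(k+2); and
  -- the correction from f', contributing (k+2)r₀^(k+2).
  have hmain := ((hS.mul ((tendsto_pow_mul_cross hx hy).add
      ((tendsto_pow_mul_cross hx hz).const_mul (k : ℝ)))).sub
      ((tendsto_const_nhds (x := 2 * ((k : ℝ) + 1) * r₀ ^ (k + 2))).div (hS.add_const 1)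
        (by norm_num))).add
      (((hS.div hsx one_ne_zero).mul (((tendsto_const_nhds
        (x := ((k : ℝ) + 2) / 2 * r₀ ^ (k + 2))).div hX one_ne_zero))).mul
        ((hx.tendsto.div hy.tendsto one_ne_zero).const_add 1))
  have hv : 1 * (0 + (k : ℝ) * 0) - 2 * ((k : ℝ) + 1) * r₀ ^ (k + 2) / (1 + 1)
      + 1 / 1 * (((k : ℝ) + 2) / 2 * r₀ ^ (k + 2) / 1) * (1 + 1 / 1) = r₀ ^ (k + 2) := by ring
  rw [hv] at hmain
  refine hmain.congr' ?_
  filter_upwards [eventually_gt_atTop r₀, hx.tendsto.eventually (lt_mem_nhds one_pos),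
    hy.tendsto.eventually (lt_mem_nhds one_pos),
    hz.tendsto.eventually (lt_mem_nhds one_pos)] with r hr hxr hyr hzr
  have hr' : 0 < r := hr₀.trans hr
  have hX1 : 0 < 1 - (r₀ / r) ^ (k + 2) := sub_pos.2 (pow_ratio_lt_one hr₀ hr)
  have hrX : r₀ ^ (k + 2) = r ^ (k + 2) * (r₀ / r) ^ (k + 2) := by
    rw [← mul_pow, mul_div_cancel₀ _ hr'.ne']
  have hs := Real.sqrt_pos.2 hxr
  have hsX := Real.sqrt_pos.2 hX1
  have hsX2 := Real.sq_sqrt hX1.le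
  simp only [Pi.div_apply]
  rw [hrX]
  generalize Real.sqrt (1 - (r₀ / r) ^ (k + 2)) = S at hsX hsX2 ⊢
  have h1 : r ^ (k + 2) * (r₀ / r) ^ (k + 2) = r ^ (k + 2) * (1 - S) * (1 + S) := by
    rw [show r ^ (k + 2) * (1 - S) * (1 + S) = r ^ (k + 2) * (1 - S ^ 2) by ring, hsX2]; ring
  have h2 : 2 * ((k : ℝ) + 1) * (r ^ (k + 2) * (r₀ / r) ^ (k + 2)) / (S + 1)
      = 2 * (k + 1) * (r ^ (k + 2) * (1 - S)) := by
    rw [h1]; field_simp; ring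
  rw [h2]
  generalize (r₀ / r) ^ (k + 2) = X at hX1 ⊢
  generalize Real.sqrt (x r) = s at hs ⊢
  field_simp
  ring

theorem exp_two_mul_eq_sq (t : ℝ) : Real.exp (2 * t) = Real.exp t ^ 2 := by
  rw [← Real.exp_nat_mul]; rfl

theorem tendsto_exp_v_div {k : ℕ} {r₀ : ℝ} (hr₀ : 0 < r₀) {v : ℝ → ℝ}
    (hy : IsFastToOne k fun r => Real.exp (2 * v r) / hmF k r₀ r) :
    Tendsto (fun r => Real.exp (v r) / r) atTop (𝓝 1) := by
  have h := hy.tendsto.sqrt.mul (tendsto_sqrt_one_sub k r₀)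
  rw [Real.sqrt_one, one_mul] at h
  refine h.congr' ?_
  filter_upwards [eventually_gt_atTop r₀] with r hr
  have hr' : 0 < r := hr₀.trans hr
  have hX1 : 0 < 1 - (r₀ / r) ^ (k + 2) := sub_pos.2 (pow_ratio_lt_one hr₀ hr)
  rw [← Real.sqrt_mul' _ hX1.le, ← Real.sqrt_sq (x := Real.exp (v r) / r) (by positivity)]
  congr 1
  rw [exp_two_mul_eq_sq, hmF]
  field_simp

theorem tendsto_exp_w_div {k : ℕ} {w : ℝ → ℝ}
    (hz : IsFastToOne k fun r => Real.exp (2 * w r) / r ^ 2) :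
    Tendsto (fun r => Real.exp (w r) / r) atTop (𝓝 1) := by
  have h := hz.tendsto.sqrt
  rw [Real.sqrt_one] at h
  refine h.congr' ?_
  filter_upwards [eventually_gt_atTop 0] with r hr
  rw [exp_two_mul_eq_sq, ← div_pow, Real.sqrt_sq (by positivity)]

theorem tendsto_torusDensity {k : ℕ} {v w : ℝ → ℝ}
    (hv : Tendsto (fun r => Real.exp (v r) / r) atTop (𝓝 1))
    (hw : Tendsto (fun r => Real.exp (w r) / r) atTop (𝓝 1)) :
    Tendsto (fun r => r * torusDensity k v w r / r ^ (k + 2)) atTop (𝓝 1) := by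
  have h := hv.mul (hw.pow k)
  simp only [one_pow, one_mul] at h
  refine h.congr' ?_
  filter_upwards [eventually_gt_atTop 0] with r hr
  rw [torusDensity, Real.exp_add, Real.exp_nat_mul, div_pow]
  field_simp
  ring

/-- The density is exactly the algebraic bracket minus 2rH, both weighted by the torus density. The
bracket has a known limit, so the mass measures how fast H approaches its hyperbolic value k + 1. -/
theorem tendsto_meanCurv_defect {k : ℕ} {r₀ : ℝ} (hr₀ : 0 < r₀) {u v w : ℝ → ℝ}
    (hx : IsFastToOne k fun r => Real.exp (2 * u r) / (1 / hmF k r₀ r))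
    (hy : IsFastToOne k fun r => Real.exp (2 * v r) / hmF k r₀ r)
    (hz : IsFastToOne k fun r => Real.exp (2 * w r) / r ^ 2) {μ : ℝ}
    (hμ : Tendsto (massDensity k r₀ u v w) atTop (𝓝 μ)) :
    Tendsto (fun r => r * torusDensity k v w r * (meanCurv k u v w r - (k + 1))) atTop
      (𝓝 ((r₀ ^ (k + 2) - μ) / 2)) := by
  have h1 := (tendsto_torusDensity (k := k) (tendsto_exp_v_div hr₀ hy) (tendsto_exp_w_div hz)).mul
    (tendsto_massBracket hr₀ hx hy hz)
  have h2 := (h1.sub hμ).div_const 2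
  rw [one_mul] at h2
  refine h2.congr' ?_
  filter_upwards [eventually_gt_atTop r₀] with r hr
  have hr' : 0 < r := hr₀.trans hr
  have hX1 : 0 < 1 - (r₀ / r) ^ (k + 2) := sub_pos.2 (pow_ratio_lt_one hr₀ hr)
  unfold massDensity
  rw [(hasDerivAt_hmF k r₀ hr').deriv]
  have s1 : Real.exp (2 * u r - 2 * v r) = Real.exp (u r) ^ 2 / Real.exp (v r) ^ 2 := by
    rw [Real.exp_sub, exp_two_mul_eq_sq, exp_two_mul_eq_sq]
  have s2 : Real.exp (2 * u r - 2 * w r) = Real.exp (u r) ^ 2 / Real.exp (w r) ^ 2 := by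
    rw [Real.exp_sub, exp_two_mul_eq_sq, exp_two_mul_eq_sq]
  have s4 : ∀ t : ℝ, Real.exp (-2 * t) = (Real.exp t ^ 2)⁻¹ := fun t => by
    rw [← exp_two_mul_eq_sq, ← Real.exp_neg, ← neg_mul]
  have hs : Real.sqrt (Real.exp (2 * u r) / (1 / hmF k r₀ r))
      = Real.exp (u r) * (r * Real.sqrt (1 - (r₀ / r) ^ (k + 2))) := by
    rw [div_div_eq_mul_div, div_one, exp_two_mul_eq_sq, hmF, Real.sqrt_mul (by positivity),
      Real.sqrt_sq (Real.exp_pos _).le, Real.sqrt_mul (by positivity), Real.sqrt_sq hr'.le]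
  rw [hs, s1, s2, s4, s4]
  simp only [exp_two_mul_eq_sq, hmF, Real.exp_neg]
  have hsX := Real.sqrt_pos.2 hX1
  generalize Real.sqrt (1 - (r₀ / r) ^ (k + 2)) = S at hsX ⊢
  generalize (r₀ / r) ^ (k + 2) = X at hX1 ⊢
  have a1 := Real.exp_pos (u r)
  have a2 := Real.exp_pos (v r)
  have a3 := Real.exp_pos (w r)
  field_simp
  ring

/-! ### Regularity at the core. -/

/-- The coordinates of the point with given `r`, `θ` and `x = 0`. -/
def meridianPoint (k : ℕ) (r θ : ℝ) : Fin (k + 2) → ℝ :=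
  fun i => if i = 0 then r else if i = 1 then θ else 0

theorem pd_polarMap_zero {k : ℕ} {r₀ : ℝ} {ρ : ℝ → ℝ} (q : Fin (k + 2) → ℝ) (a : Fin (k + 2)) :
    pd 0 (fun p => polarMap k r₀ ρ p a) q
      = if a = 0 then deriv ρ (q 0) * Real.cos (2 * Real.pi * q 1 / thetaPeriod k r₀)
        else if a = 1 then deriv ρ (q 0) * Real.sin (2 * Real.pi * q 1 / thetaPeriod k r₀)
        else 0 := by
  unfold pd polarMap
  have h1 : (1 : Fin (k + 2)) ≠ 0 := by simp
  by_cases ha : a = 0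
  · simp [ha]
  · by_cases hb : a = 1
    · simp [hb]
    · simp [ha, hb]

theorem pd_polarMap_one {k : ℕ} {r₀ : ℝ} {ρ : ℝ → ℝ} (q : Fin (k + 2) → ℝ) (a : Fin (k + 2)) :
    pd 1 (fun p => polarMap k r₀ ρ p a) q
      = if a = 0 then ρ (q 0) * (-Real.sin (2 * Real.pi * q 1 / thetaPeriod k r₀)
          * (2 * Real.pi / thetaPeriod k r₀))
        else if a = 1 then ρ (q 0) * (Real.cos (2 * Real.pi * q 1 / thetaPeriod k r₀)
          * (2 * Real.pi / thetaPeriod k r₀))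
        else 0 := by
  unfold pd polarMap
  have h1 : (0 : Fin (k + 2)) ≠ 1 := by simp
  have hl : HasDerivAt (fun t => 2 * Real.pi * t / thetaPeriod k r₀)
      (2 * Real.pi / thetaPeriod k r₀) (q 1) := by
    simpa using ((hasDerivAt_id (q 1)).const_mul (2 * Real.pi)).div_const (thetaPeriod k r₀)
  by_cases ha : a = 0
  · simp only [ha, if_true, Function.update_self, Function.update_of_ne h1]
    exact (hl.cos.const_mul _).deriv
  · by_cases hb : a = 1
    · simp only [hb, if_true, if_false, Function.update_self, Function.update_of_ne h1,
        h1.symm]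
      exact (hl.sin.const_mul _).deriv
    · simp [ha, hb]

theorem pd_polarMap_of_ne {k : ℕ} {r₀ : ℝ} {ρ : ℝ → ℝ} (q : Fin (k + 2) → ℝ) {i : Fin (k + 2)}
    (hi : i ≠ 0) (hi' : i ≠ 1) (a : Fin (k + 2)) :
    pd i (fun p => polarMap k r₀ ρ p a) q = if a = i then 1 else 0 := by
  unfold pd polarMap
  by_cases ha : a = 0
  · simp [ha, Function.update_of_ne hi'.symm, hi.symm]
  · by_cases hb : a = 1
    · simp [hb, Function.update_of_ne hi.symm, hi'.symm]
    · by_cases hc : a = i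
      · subst hc; simp [ha, hb]
      · simp [ha, hb, hc]

theorem pullback_eq_single {d : ℕ} {Φ : (Fin d → ℝ) → (Fin d → ℝ)}
    {G : (Fin d → ℝ) → Matrix (Fin d) (Fin d) ℝ} {q : Fin d → ℝ} {i a : Fin d} {x : ℝ}
    (h : ∀ c, pd i (fun p => Φ p c) q = if c = a then x else 0) :
    pullback Φ G q i i = x ^ 2 * G (Φ q) a a := by
  simp only [pullback, Matrix.of_apply, h]
  simp [sq]

theorem polarMap_meridianPoint_zero (k : ℕ) (r₀ : ℝ) (ρ : ℝ → ℝ) (r : ℝ) :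
    polarMap k r₀ ρ (meridianPoint k r 0) = Pi.single 0 (ρ r) := by
  funext i
  unfold polarMap meridianPoint
  by_cases h0 : i = 0
  · simp [h0]
  · by_cases h1 : i = 1 <;> simp [h0, h1]

theorem polarMap_meridianPoint_quarter {k : ℕ} {r₀ : ℝ} (h : thetaPeriod k r₀ ≠ 0) (ρ : ℝ → ℝ)
    (r : ℝ) :
    polarMap k r₀ ρ (meridianPoint k r (thetaPeriod k r₀ / 4)) = Pi.single 1 (ρ r) := by
  have hq : 2 * Real.pi * (thetaPeriod k r₀ / 4) / thetaPeriod k r₀ = Real.pi / 2 := by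
    field_simp; norm_num
  funext i
  unfold polarMap meridianPoint
  by_cases h0 : i = 0
  · simp [h0, hq]
  · by_cases h1 : i = 1 <;> simp [h0, h1, hq]

/-- The components of a warped metric which is smooth across the core are given by smooth
functions of the polar radius. -/
theorem IsSmoothMetricOnBulk.exists_profile {k : ℕ} {r₀ : ℝ} (hr₀ : 0 < r₀) {u v w : ℝ → ℝ}
    (h : IsSmoothMetricOnBulk k r₀ (warpedMetric k u v w)) :
    ∃ ρ a b : ℝ → ℝ, ContDiffOn ℝ ∞ ρ (Set.Ioi r₀) ∧ (∀ r, r₀ < r → 0 < ρ r ∧ 0 < deriv ρ r) ∧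
      Tendsto ρ (𝓝[>] r₀) (𝓝 0) ∧ ContDiff ℝ ∞ a ∧ ContDiff ℝ ∞ b ∧ (∀ t, 0 < a t) ∧
      (∀ t, 0 < b t) ∧ a 0 = b 0 ∧
      (∀ r, r₀ < r → Real.exp (2 * u r) = deriv ρ r ^ 2 * b (ρ r) ∧
        Real.exp (2 * v r) = (((k : ℝ) + 2) * r₀ / 2 * ρ r) ^ 2 * a (ρ r)) ∧
      (k ≠ 0 → ∃ c : ℝ → ℝ, ContDiff ℝ ∞ c ∧ (∀ t, 0 < c t) ∧
        ∀ r, r₀ < r → Real.exp (2 * w r) = c (ρ r)) := by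
  obtain ⟨ρ, G, hρ, hpos, hρ0, -, hG, hGpos, hpull⟩ := h
  have hper : thetaPeriod k r₀ ≠ 0 := by
    unfold thetaPeriod; have := Real.pi_pos; positivity
  have hline : ∀ j : Fin (k + 2), ContDiff ℝ ∞ fun t : ℝ => (Pi.single j t : Fin (k + 2) → ℝ) :=
    fun j => (ContinuousLinearMap.single ℝ (fun _ : Fin (k + 2) => ℝ) j).contDiff
  have hsm : ∀ i j l, ContDiff ℝ ∞ fun t : ℝ => G (Pi.single l t) i j := fun i j l =>
    (hG i j).comp (hline l)
  have hdiag : ∀ p i, 0 < G p i i := fun p i => (hGpos p).diag_pos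
  have h10 : (1 : Fin (k + 2)) ≠ 0 := by simp
  have hu : ∀ r, r₀ < r → Real.exp (2 * u r) = deriv ρ r ^ 2 * G (Pi.single 0 (ρ r)) 0 0 := by
    intro r hr
    have h1 := congrFun (congrFun (hpull (meridianPoint k r 0) (by simpa [meridianPoint])) 0) 0
    rw [pullback_eq_single (a := 0) (x := deriv ρ r), polarMap_meridianPoint_zero] at h1
    · rw [h1]; simp [warpedMetric, meridianPoint]
    · intro c
      rw [pd_polarMap_zero]
      simp [meridianPoint]
  -- After a quarter turn ∂_r points along the second Cartesian axis, so the same radial component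
  -- is read off from G₁₁.
  have hu' : ∀ r, r₀ < r → Real.exp (2 * u r) = deriv ρ r ^ 2 * G (Pi.single 1 (ρ r)) 1 1 := by
    intro r hr
    have h1 := congrFun (congrFun (hpull (meridianPoint k r (thetaPeriod k r₀ / 4))
      (by simpa [meridianPoint])) 0) 0
    rw [pullback_eq_single (a := 1) (x := deriv ρ r), polarMap_meridianPoint_quarter hper] at h1
    · rw [h1]; simp [warpedMetric, meridianPoint]
    · intro c
      have hq : 2 * Real.pi * (thetaPeriod k r₀ / 4) / thetaPeriod k r₀ = Real.pi / 2 := by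
        field_simp; norm_num
      rw [pd_polarMap_zero]
      by_cases hc : c = 0 <;> simp [meridianPoint, hq, hc]
  have hv : ∀ r, r₀ < r → Real.exp (2 * v r)
      = (((k : ℝ) + 2) * r₀ / 2 * ρ r) ^ 2 * G (Pi.single 0 (ρ r)) 1 1 := by
    intro r hr
    have h1 := congrFun (congrFun (hpull (meridianPoint k r 0) (by simpa [meridianPoint])) 1) 1
    have hκ : 2 * Real.pi / thetaPeriod k r₀ = ((k : ℝ) + 2) * r₀ / 2 := by
      unfold thetaPeriod; have := Real.pi_pos; push_cast; field_simp; norm_num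
    rw [pullback_eq_single (a := 1) (x := ((k : ℝ) + 2) * r₀ / 2 * ρ r),
      polarMap_meridianPoint_zero] at h1
    · rw [h1]; simp [warpedMetric, meridianPoint]
    · intro c
      rw [pd_polarMap_one, hκ]
      by_cases hc : c = 0
      · simp [meridianPoint, hc]
      · simp [meridianPoint, hc, mul_comm]
  refine ⟨ρ, fun t => G (Pi.single 0 t) 1 1, fun t => G (Pi.single 0 t) 0 0, hρ, hpos, hρ0,
    hsm 1 1 0, hsm 0 0 0, fun t => hdiag _ _, fun t => hdiag _ _, ?_,
    fun r hr => ⟨hu r hr, hv r hr⟩, ?_⟩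
  -- Absence of a conical singularity: the two expressions for the radial component agree, and at ρ
  -- = 0 they become G₀₀ = G₁₁ at the origin.
  · have h1 : Tendsto (fun r => G (Pi.single 0 (ρ r)) 0 0) (𝓝[>] r₀)
        (𝓝 (G (Pi.single 0 (0 : ℝ)) 0 0)) :=
      ((hsm 0 0 0).continuous.tendsto 0).comp hρ0
    have h2 : Tendsto (fun r => G (Pi.single 1 (ρ r)) 1 1) (𝓝[>] r₀)
        (𝓝 (G (Pi.single 1 (0 : ℝ)) 1 1)) :=
      ((hsm 1 1 1).continuous.tendsto 0).comp hρ0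
    have h3 : (fun r => G (Pi.single 0 (ρ r)) 0 0) =ᶠ[𝓝[>] r₀]
        fun r => G (Pi.single 1 (ρ r)) 1 1 := by
      filter_upwards [self_mem_nhdsWithin] with r hr
      have := (hu r hr).symm.trans (hu' r hr)
      exact mul_left_cancel₀ (pow_ne_zero 2 (hpos r hr).2.ne') this
    have h4 := tendsto_nhds_unique (h1.congr' h3) h2
    simp only [Pi.single_zero] at h4 ⊢
    exact h4.symm
  · intro hk
    obtain ⟨j, hj0, hj1⟩ : ∃ j : Fin (k + 2), j ≠ 0 ∧ j ≠ 1 :=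
      ⟨⟨2, by omega⟩, by simp [Fin.ext_iff], by simp [Fin.ext_iff]⟩
    refine ⟨fun t => G (Pi.single 0 t) j j, hsm _ _ 0, fun t => hdiag _ _, fun r hr => ?_⟩
    have h1 := congrFun (congrFun (hpull (meridianPoint k r 0) (by simpa [meridianPoint])) j) j
    rw [pullback_eq_single (pd_polarMap_of_ne _ hj0 hj1), polarMap_meridianPoint_zero, one_pow,
      one_mul] at h1
    dsimp only
    rw [h1]
    simp [warpedMetric, meridianPoint, hj0, hj1]

/-- With e^v = κρ√a and e^u = ρ_r√b, where ρ_r = dρ/dr, the factor ρ_r cancels in e^v p = κ(√a +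
ρ(√a)')/√b, the inner prime being d/dρ. The limit is κ = (k+2)r₀/2 because a(0) = b(0). The torus
part e^v q vanishes in the limit since e^{2w} is a smooth positive function of ρ. -/
theorem tendsto_core {k : ℕ} {r₀ : ℝ} (hr₀ : 0 < r₀) {u v w : ℝ → ℝ}
    (hvs : ContDiffOn ℝ ∞ v (Set.Ioi r₀)) (hws : ContDiffOn ℝ ∞ w (Set.Ioi r₀))
    (h : IsSmoothMetricOnBulk k r₀ (warpedMetric k u v w)) :
    Tendsto (fun r => Real.exp (v r)) (𝓝[>] r₀) (𝓝 0) ∧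
    Tendsto (fun r => Real.exp (v r) * meanCurv k u v w r) (𝓝[>] r₀)
      (𝓝 (((k : ℝ) + 2) * r₀ / 2)) := by
  obtain ⟨ρ, a, b, hρ, hpos, hρ0, ha, hb, hap, hbp, hab, huv, hc⟩ := h.exists_profile hr₀
  set κ : ℝ := ((k : ℝ) + 2) * r₀ / 2 with hκ
  have hκpos : 0 < κ := by positivity
  have hα : ContDiff ℝ ∞ fun t => Real.sqrt (a t) := ha.sqrt fun t => (hap t).ne'
  have hβ : ContDiff ℝ ∞ fun t => Real.sqrt (b t) := hb.sqrt fun t => (hbp t).ne'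
  have hβp : ∀ t, 0 < Real.sqrt (b t) := fun t => Real.sqrt_pos.2 (hbp t)
  have hev : ∀ r, r₀ < r → Real.exp (v r) = κ * ρ r * Real.sqrt (a (ρ r)) := by
    intro r hr
    have h1 := (huv r hr).2
    have h2 := (hpos r hr).1
    rw [← Real.sqrt_sq (Real.exp_pos (v r)).le, ← exp_two_mul_eq_sq, h1,
      Real.sqrt_mul (by positivity), Real.sqrt_sq (by positivity)]
  have heu : ∀ r, r₀ < r → Real.exp (u r) = deriv ρ r * Real.sqrt (b (ρ r)) := by
    intro r hr
    rw [← Real.sqrt_sq (Real.exp_pos (u r)).le, ← exp_two_mul_eq_sq, (huv r hr).1,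
      Real.sqrt_mul (by positivity), Real.sqrt_sq (hpos r hr).2.le]
  have hdα : Continuous (deriv fun t => Real.sqrt (a t)) := hα.continuous_deriv (by simp)
  have hlim : ∀ F : ℝ → ℝ, Continuous F → Tendsto (fun r => F (ρ r)) (𝓝[>] r₀) (𝓝 (F 0)) :=
    fun F hF => (hF.tendsto 0).comp hρ0
  have hp : Tendsto (fun r => Real.exp (v r) * radialDeriv u v r) (𝓝[>] r₀) (𝓝 κ) := by
    have h1 : Tendsto (fun r => κ * (Real.sqrt (a (ρ r)) + ρ r *
        deriv (fun t => Real.sqrt (a t)) (ρ r)) / Real.sqrt (b (ρ r))) (𝓝[>] r₀)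
        (𝓝 (κ * (Real.sqrt (a 0) + 0 * deriv (fun t => Real.sqrt (a t)) 0)
          / Real.sqrt (b 0))) :=
      hlim (fun t => κ * (Real.sqrt (a t) + t * deriv (fun t => Real.sqrt (a t)) t)
        / Real.sqrt (b t)) ((continuous_const.mul (hα.continuous.add
          (continuous_id.mul hdα))).div hβ.continuous fun t => (hβp t).ne')
    have h2 : κ * (Real.sqrt (a 0) + 0 * deriv (fun t => Real.sqrt (a t)) 0)
        / Real.sqrt (b 0) = κ := by
      rw [hab, zero_mul, add_zero, mul_div_cancel_right₀ _ (hβp 0).ne']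
    rw [h2] at h1
    refine h1.congr' ?_
    filter_upwards [self_mem_nhdsWithin] with r hr
    have hρd := hasDerivAt_of_contDiffOn hρ hr
    have hαd : HasDerivAt (fun t => Real.sqrt (a t)) (deriv (fun t => Real.sqrt (a t)) (ρ r))
        (ρ r) := (hα.differentiable (by simp) _).hasDerivAt
    have h3 := ((hρd.const_mul κ).mul (hαd.comp r hρd))
    have h4 := (hasDerivAt_of_contDiffOn hvs hr).exp
    have h5 : (fun r => Real.exp (v r)) =ᶠ[𝓝 r] fun r => κ * ρ r * Real.sqrt (a (ρ r)) := by
      filter_upwards [Ioi_mem_nhds hr] with s hs using hev s hs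
    have h6 := h4.unique (h3.congr_of_eventuallyEq h5)
    have h7 : Real.exp (v r) * radialDeriv u v r
        = (Real.exp (v r) * deriv v r) / Real.exp (u r) := by
      rw [radialDeriv, Real.exp_neg]; ring
    rw [h7, h6, heu r hr]
    have := (hpos r hr).2
    have := hβp (ρ r)
    simp only [Function.comp_apply]
    field_simp
  have hv0 : Tendsto (fun r => Real.exp (v r)) (𝓝[>] r₀) (𝓝 0) := by
    have h1 := hlim (fun t => κ * t * Real.sqrt (a t))
      ((continuous_const.mul continuous_id).mul hα.continuous)
    simp only [mul_zero, zero_mul] at h1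
    refine h1.congr' ?_
    filter_upwards [self_mem_nhdsWithin] with r hr using (hev r hr).symm
  refine ⟨hv0, ?_⟩
  have hq : Tendsto (fun r => Real.exp (v r) * (k * radialDeriv u w r)) (𝓝[>] r₀) (𝓝 0) := by
    by_cases hk : k = 0
    · subst hk; simp
    · obtain ⟨c, hcs, hcp, hcw⟩ := hc hk
      have hdc : Continuous (deriv c) := hcs.continuous_deriv (by simp)
      have h1 := hlim (fun t => κ * t * Real.sqrt (a t) *
        (k * (deriv c t / (2 * c t * Real.sqrt (b t)))))
        (((continuous_const.mul continuous_id).mul hα.continuous).mul (continuous_const.mul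
          (hdc.div ((continuous_const.mul hcs.continuous).mul hβ.continuous)
            fun t => (mul_pos (mul_pos two_pos (hcp t)) (hβp t)).ne')))
      simp only [mul_zero, zero_mul] at h1
      refine h1.congr' ?_
      filter_upwards [self_mem_nhdsWithin] with r hr
      have hρd := hasDerivAt_of_contDiffOn hρ hr
      have hcd : HasDerivAt c (deriv c (ρ r)) (ρ r) :=
        (hcs.differentiable (by simp) _).hasDerivAt
      have h4 := ((hasDerivAt_of_contDiffOn hws hr).const_mul 2).exp
      have h5 : (fun r => Real.exp (2 * w r)) =ᶠ[𝓝 r] fun r => c (ρ r) := by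
        filter_upwards [Ioi_mem_nhds hr] with s hs using hcw s hs
      have h6 := h4.unique ((hcd.comp r hρd).congr_of_eventuallyEq h5)
      rw [hcw r hr] at h6
      have hcr := hcp (ρ r)
      have h7 : deriv w r = deriv c (ρ r) * deriv ρ r / (2 * c (ρ r)) := by
        rw [← h6]; field_simp
      rw [radialDeriv, Real.exp_neg, h7, heu r hr, hev r hr]
      have := (hpos r hr).2
      have := hβp (ρ r)
      field_simp
  have := hp.add hq
  rw [add_zero] at this
  refine this.congr fun r => ?_
  rw [meanCurv]; ring

/-! ### The differential inequality for the mean curvature. -/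

/-- The differential inequality on the mean curvature which expresses the lower bound on
the scalar curvature. -/
theorem radialDeriv_meanCurv_le {k : ℕ} {r₀ : ℝ} {u v w : ℝ → ℝ}
    (hu : ContDiffOn ℝ ∞ u (Set.Ioi r₀)) (hv : ContDiffOn ℝ ∞ v (Set.Ioi r₀))
    (hw : ContDiffOn ℝ ∞ w (Set.Ioi r₀))
    (hR : ∀ q : Fin (k + 2) → ℝ, r₀ < q 0 →
      -(((k + 2 : ℕ) : ℝ) * (((k + 2 : ℕ) : ℝ) - 1)) ≤
        scalarCurvature (warpedMetric k u v w) q) {r : ℝ} (hr : r₀ < r) :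
    2 * radialDeriv u (meanCurv k u v w) r ≤ ((k : ℝ) + 2) * (k + 1)
      - meanCurv k u v w r ^ 2 - radialDeriv u v r ^ 2 - k * radialDeriv u w r ^ 2 := by
  have h := hR (fun _ => r) hr
  rw [scalarCurvature_warpedMetric hu hv hw (q := fun _ => r) hr] at h
  push_cast at h
  linarith

theorem hasDerivAt_meanCurv' {k : ℕ} {r₀ : ℝ} {u v w : ℝ → ℝ}
    (hu : ContDiffOn ℝ ∞ u (Set.Ioi r₀)) (hv : ContDiffOn ℝ ∞ v (Set.Ioi r₀))
    (hw : ContDiffOn ℝ ∞ w (Set.Ioi r₀)) {r : ℝ} (hr : r₀ < r) :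
    HasDerivAt (meanCurv k u v w) (Real.exp (u r) * radialDeriv u (meanCurv k u v w) r) r := by
  have h := (hasDerivAt_meanCurv (k := k) hu hv hw hr).differentiableAt.hasDerivAt
  rwa [radialDeriv, ← mul_assoc, ← Real.exp_add, add_neg_cancel, Real.exp_zero, one_mul]

/-- Above the level k + 1 the mean curvature is nonincreasing in r, so going inwards from infinity
it cannot come down to that level. -/
theorem lt_meanCurv {k : ℕ} {r₀ : ℝ} {u v w : ℝ → ℝ}
    (hu : ContDiffOn ℝ ∞ u (Set.Ioi r₀)) (hv : ContDiffOn ℝ ∞ v (Set.Ioi r₀))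
    (hw : ContDiffOn ℝ ∞ w (Set.Ioi r₀))
    (hR : ∀ r, r₀ < r → 2 * radialDeriv u (meanCurv k u v w) r ≤ ((k : ℝ) + 2) * (k + 1)
      - meanCurv k u v w r ^ 2 - radialDeriv u v r ^ 2 - k * radialDeriv u w r ^ 2)
    (hev : ∀ᶠ r in atTop, (k : ℝ) + 1 < meanCurv k u v w r) {r : ℝ} (hr : r₀ < r) :
    (k : ℝ) + 1 < meanCurv k u v w r := by
  by_contra! hle
  obtain ⟨R, hRr, hRH⟩ := ((eventually_ge_atTop r).and hev).exists
  have hd : ∀ x, r₀ < x → HasDerivAt (meanCurv k u v w) _ x := fun x hx =>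
    hasDerivAt_meanCurv' hu hv hw hx
  have hcont : ContinuousOn (meanCurv k u v w) (Set.Icc r R) := fun x hx =>
    (hd x (hr.trans_le hx.1)).continuousAt.continuousWithinAt
  have hclosed : IsCompact (Set.Icc r R ∩ meanCurv k u v w ⁻¹' Set.Iic ((k : ℝ) + 1)) :=
    isCompact_Icc.of_isClosed_subset (hcont.preimage_isClosed_of_isClosed isClosed_Icc isClosed_Iic)
      Set.inter_subset_left
  -- Here s is the last point of [r, R] with H ≤ k + 1; beyond it H is nonincreasing, so H(R) ≤ H(s)
  -- ≤ k + 1, a contradiction.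
  obtain ⟨s, ⟨⟨hs1, hs2⟩, hs3⟩, hmax⟩ := hclosed.exists_isGreatest
    ⟨r, ⟨le_rfl, hRr⟩, hle⟩
  have hgt : ∀ x ∈ Set.Ioo s R, (k : ℝ) + 1 < meanCurv k u v w x := by
    intro x hx
    by_contra! hx'
    exact absurd (hmax ⟨⟨hs1.trans hx.1.le, hx.2.le⟩, hx'⟩) (not_le.2 hx.1)
  have hanti : AntitoneOn (meanCurv k u v w) (Set.Icc s R) := by
    apply antitoneOn_of_deriv_nonpos (convex_Icc s R)
      (hcont.mono (Set.Icc_subset_Icc_left hs1))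
    · intro x hx
      rw [interior_Icc] at hx
      exact (hd x (hr.trans_le (hs1.trans hx.1.le))).differentiableAt.differentiableWithinAt
    · intro x hx
      rw [interior_Icc] at hx
      have hx0 : r₀ < x := hr.trans_le (hs1.trans hx.1.le)
      rw [(hd x hx0).deriv]
      refine mul_nonpos_of_nonneg_of_nonpos (Real.exp_pos _).le ?_
      have h1 := hR x hx0
      have h2 := hgt x hx
      -- Cauchy–Schwarz with its remainder: p² + kq² ≥ H²/(k+1), which makes the right side of the
      -- curvature inequality nonpositive once H > k + 1.
      have h3 : ((k : ℝ) + 1) * (radialDeriv u v x ^ 2 + k * radialDeriv u w x ^ 2)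
          = meanCurv k u v w x ^ 2 + k * (radialDeriv u v x - radialDeriv u w x) ^ 2 := by
        rw [meanCurv]; ring
      have hk : (0 : ℝ) ≤ k := Nat.cast_nonneg k
      have h4 : ((k : ℝ) + 1) ^ 2 ≤ meanCurv k u v w x ^ 2 := by gcongr
      have h5 : 0 ≤ (k : ℝ) * (radialDeriv u v x - radialDeriv u w x) ^ 2 := by positivity
      have h6 : ((k : ℝ) + 1) * (2 * radialDeriv u (meanCurv k u v w) x) ≤ 0 := by
        nlinarith
      nlinarith
  have := hanti ⟨le_rfl, hs2⟩ ⟨hs2, le_rfl⟩ hs2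
  simp only [Set.mem_preimage, Set.mem_Iic] at hs3
  linarith

/-! ### The comparison Horowitz–Myers torus. -/

/-- The root of `H² - k (k + 2)`. -/
def hmRoot (k : ℕ) (H : ℝ) : ℝ := Real.sqrt (H ^ 2 - k * (k + 2))

/-- The value of `√f / r` on the torus of mean curvature `H` in a Horowitz-Myers metric. -/
def hmParam (k : ℕ) (H : ℝ) : ℝ := (k + 2) / (H + hmRoot k H)

theorem one_lt_radicand {k : ℕ} {H : ℝ} (hH : (k : ℝ) + 1 < H) : 1 < H ^ 2 - k * (k + 2) := by
  have hk : (0 : ℝ) ≤ k := Nat.cast_nonneg k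
  nlinarith

theorem one_lt_hmRoot {k : ℕ} {H : ℝ} (hH : (k : ℝ) + 1 < H) : 1 < hmRoot k H :=
  Real.lt_sqrt_of_sq_lt (by simpa using one_lt_radicand hH)

theorem hmRoot_sq {k : ℕ} {H : ℝ} (hH : (k : ℝ) + 1 < H) :
    hmRoot k H ^ 2 = H ^ 2 - k * (k + 2) :=
  Real.sq_sqrt (zero_le_one.trans (one_lt_radicand hH).le)

theorem hmParam_pos {k : ℕ} {H : ℝ} (hH : (k : ℝ) + 1 < H) : 0 < hmParam k H := by
  have hk : (0 : ℝ) ≤ k := Nat.cast_nonneg k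
  have := one_lt_hmRoot hH
  exact div_pos (by positivity) (by linarith)

/-- This is the model relation between H and E = √f/r. For k > 0, `hmParam` is the smaller root of
the quadratic, (H - S)/k with S = `hmRoot`; the rationalized form (k+2)/(H + S) also covers k = 0.
-/
theorem meanCurv_eq_hmParam {k : ℕ} {H : ℝ} (hH : (k : ℝ) + 1 < H) :
    2 * hmParam k H * H = k + 2 + k * hmParam k H ^ 2 := by
  have hk : (0 : ℝ) ≤ k := Nat.cast_nonneg k
  have h1 := one_lt_hmRoot hH
  have h2 := hmRoot_sq hH
  have h3 : 0 < H + hmRoot k H := by linarith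
  rw [hmParam]
  field_simp
  linear_combination -h2

/-- It identifies S with the value H - kE of p in the model. -/
theorem hmRoot_eq_hmParam {k : ℕ} {H : ℝ} (hH : (k : ℝ) + 1 < H) :
    2 * hmParam k H * hmRoot k H = k + 2 - k * hmParam k H ^ 2 := by
  have hk : (0 : ℝ) ≤ k := Nat.cast_nonneg k
  have h1 := one_lt_hmRoot hH
  have h3 : 0 < H + hmRoot k H := by linarith
  have h4 : hmParam k H * (H + hmRoot k H) = k + 2 := by
    rw [hmParam, div_mul_cancel₀ _ h3.ne']
  linear_combination 2 * h4 - meanCurv_eq_hmParam hH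

theorem hasDerivAt_hmParam {k : ℕ} {H : ℝ} (hH : (k : ℝ) + 1 < H) :
    HasDerivAt (hmParam k) (-(hmParam k H / hmRoot k H)) H := by
  have h1 := one_lt_hmRoot hH
  have h3 : 0 < H + hmRoot k H := by
    have hk : (0 : ℝ) ≤ k := Nat.cast_nonneg k
    linarith
  have hS : HasDerivAt (hmRoot k) (H / hmRoot k H) H := by
    have := (((hasDerivAt_pow 2 H).sub_const ((k : ℝ) * (k + 2))).sqrt
      (zero_lt_one.trans (one_lt_radicand hH)).ne')
    refine this.congr_deriv ?_
    change _ / (2 * hmRoot k H) = _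
    field_simp
    simp
  have := (hasDerivAt_const H ((k : ℝ) + 2)).div ((hasDerivAt_id H).add hS) h3.ne'
  refine this.congr_deriv ?_
  simp only [Pi.add_apply, id]
  rw [hmParam]
  have : 0 < hmRoot k H := by linarith
  field_simp
  ring

theorem continuousAt_hmParam (k : ℕ) : Tendsto (hmParam k) (𝓝 ((k : ℝ) + 1)) (𝓝 1) := by
  have hk : (0 : ℝ) ≤ k := Nat.cast_nonneg k
  have h0 : hmRoot k ((k : ℝ) + 1) = 1 := by
    rw [hmRoot, show ((k : ℝ) + 1) ^ 2 - k * (k + 2) = 1 by ring, Real.sqrt_one]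
  have h1 : ContinuousAt (hmParam k) ((k : ℝ) + 1) := by
    unfold hmParam
    refine continuousAt_const.div (continuousAt_id.add ?_) ?_
    · unfold hmRoot; fun_prop
    · simp only [h0]; positivity
  have h2 : hmParam k ((k : ℝ) + 1) = 1 := by
    rw [hmParam, h0, div_eq_one_iff_eq (by positivity)]; ring
  simpa [ContinuousAt, h2] using h1

/-- The radius of the Horowitz-Myers torus with the same mean curvature and the same length of
the `θ`-circle. -/
def comparisonRadius (k : ℕ) (u v w : ℝ → ℝ) (r : ℝ) : ℝ :=
  Real.exp (v r) / hmParam k (meanCurv k u v w r)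

/-- The parameter `r₀^n` of the Horowitz-Myers metric containing a torus with the same mean
curvature and the same length of the `θ`-circle. -/
def comparisonMass (k : ℕ) (u v w : ℝ → ℝ) (r : ℝ) : ℝ :=
  comparisonRadius k u v w r ^ (k + 2) * (1 - hmParam k (meanCurv k u v w r) ^ 2)

theorem hasDerivAt_hmParam_meanCurv {k : ℕ} {r₀ : ℝ} {u v w : ℝ → ℝ}
    (hu : ContDiffOn ℝ ∞ u (Set.Ioi r₀)) (hv : ContDiffOn ℝ ∞ v (Set.Ioi r₀))
    (hw : ContDiffOn ℝ ∞ w (Set.Ioi r₀)) {r : ℝ} (hr : r₀ < r)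
    (hH : (k : ℝ) + 1 < meanCurv k u v w r) :
    HasDerivAt (fun r => hmParam k (meanCurv k u v w r))
      (-(Real.exp (u r) * (hmParam k (meanCurv k u v w r) / hmRoot k (meanCurv k u v w r)
        * radialDeriv u (meanCurv k u v w) r))) r := by
  refine ((hasDerivAt_hmParam hH).comp r (hasDerivAt_meanCurv' hu hv hw hr)).congr_deriv ?_
  ring

theorem hasDerivAt_comparisonRadius {k : ℕ} {r₀ : ℝ} {u v w : ℝ → ℝ}
    (hu : ContDiffOn ℝ ∞ u (Set.Ioi r₀)) (hv : ContDiffOn ℝ ∞ v (Set.Ioi r₀))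
    (hw : ContDiffOn ℝ ∞ w (Set.Ioi r₀)) {r : ℝ} (hr : r₀ < r)
    (hH : (k : ℝ) + 1 < meanCurv k u v w r) :
    HasDerivAt (comparisonRadius k u v w)
      (Real.exp (u r) * comparisonRadius k u v w r * (radialDeriv u v r
        + radialDeriv u (meanCurv k u v w) r / hmRoot k (meanCurv k u v w r))) r := by
  have hE := hmParam_pos hH
  have hS := zero_lt_one.trans (one_lt_hmRoot hH)
  refine ((hasDerivAt_of_contDiffOn hv hr).exp.div
    (hasDerivAt_hmParam_meanCurv hu hv hw hr hH) hE.ne').congr_deriv ?_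
  have h1 : deriv v r = Real.exp (u r) * radialDeriv u v r := by
    rw [radialDeriv, ← mul_assoc, ← Real.exp_add, add_neg_cancel, Real.exp_zero, one_mul]
  rw [h1, comparisonRadius]
  field_simp
  ring

/-- In the product rule the coefficient of H' is ((k+2)(1 - E²) + 2E²)/S = (k + 2 - kE²)/S, which is
2E by `hmRoot_eq_hmParam`. -/
theorem hasDerivAt_comparisonMass {k : ℕ} {r₀ : ℝ} {u v w : ℝ → ℝ}
    (hu : ContDiffOn ℝ ∞ u (Set.Ioi r₀)) (hv : ContDiffOn ℝ ∞ v (Set.Ioi r₀))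
    (hw : ContDiffOn ℝ ∞ w (Set.Ioi r₀)) {r : ℝ} (hr : r₀ < r)
    (hH : (k : ℝ) + 1 < meanCurv k u v w r) :
    HasDerivAt (comparisonMass k u v w)
      (Real.exp (u r) * comparisonRadius k u v w r ^ (k + 2) *
        ((k + 2) * (1 - hmParam k (meanCurv k u v w r) ^ 2) * radialDeriv u v r
        + 2 * hmParam k (meanCurv k u v w r) * radialDeriv u (meanCurv k u v w) r)) r := by
  have hE := hmParam_pos hH
  have hS := zero_lt_one.trans (one_lt_hmRoot hH)
  have hES := hmRoot_eq_hmParam hH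
  refine (((hasDerivAt_comparisonRadius hu hv hw hr hH).pow (k + 2)).mul
    (((hasDerivAt_hmParam_meanCurv hu hv hw hr hH).pow 2).const_sub 1)).congr_deriv ?_
  simp only [Pi.pow_apply]
  rw [show k + 2 - 1 = k + 1 from rfl]
  generalize comparisonRadius k u v w r = c
  generalize radialDeriv u (meanCurv k u v w) r = h at *
  generalize hmParam k (meanCurv k u v w r) = E at *
  generalize hmRoot k (meanCurv k u v w r) = S at *
  have : (k : ℝ) * E ^ 2 = k + 2 - 2 * E * S := by linarith
  push_cast
  field_simp
  linear_combination (-h * c ^ (k + 2)) * this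

theorem comparisonMass_bracket_le {k : ℕ} {H p q h : ℝ} (hH : (k : ℝ) + 1 < H)
    (hpq : H = p + k * q) (hle : 2 * h ≤ ((k : ℝ) + 2) * (k + 1) - H ^ 2 - p ^ 2 - k * q ^ 2) :
    (k + 2) * (1 - hmParam k H ^ 2) * p + 2 * hmParam k H * h
      ≤ -(hmParam k H * (k * (k + 1) * (hmParam k H - q) ^ 2)) := by
  have hE := hmParam_pos hH
  have hEH := meanCurv_eq_hmParam hH
  generalize hmParam k H = E at *
  have h1 : E * (2 * h) ≤ E * (((k : ℝ) + 2) * (k + 1) - H ^ 2 - p ^ 2 - k * q ^ 2) :=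
    mul_le_mul_of_nonneg_left hle hE.le
  have hp : p = H - k * q := by linarith
  have h2 : H = (k + 2 + k * E ^ 2) / (2 * E) := by field_simp; linarith
  -- After eliminating p and H, the curvature bound is a quadratic in q, and completing the square
  -- about the model value q = E leaves precisely the term that cancels in the derivative of the
  -- comparison mass.
  have h3 : E * (((k : ℝ) + 2) * (k + 1) - H ^ 2 - p ^ 2 - k * q ^ 2)
      = -((k + 2) * (1 - E ^ 2) * p) - E * (k * (k + 1) * (E - q) ^ 2) := by
    rw [hp, h2]
    field_simp
    ring
  linarith

/-- From the model relation, H - (k+1) = (1 - E)(k + 2 - kE)/(2E), so 1 - E² is the mean curvature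
defect times a factor with limit 2. E is left general so that the lemma also applies to the explicit
E of a reparametrized model. -/
theorem tendsto_comparisonMass {k : ℕ} {r₀ μ : ℝ} {H v w E : ℝ → ℝ}
    (hv : Tendsto (fun r => Real.exp (v r) / r) atTop (𝓝 1))
    (hw : Tendsto (fun r => Real.exp (w r) / r) atTop (𝓝 1))
    (hE : Tendsto E atTop (𝓝 1))
    (hEH : ∀ᶠ r in atTop, 2 * E r * H r = k + 2 + k * E r ^ 2)
    (h : Tendsto (fun r => r * torusDensity k v w r * (H r - (k + 1))) atTop
      (𝓝 ((r₀ ^ (k + 2) - μ) / 2))) :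
    Tendsto (fun r => (Real.exp (v r) / E r) ^ (k + 2) * (1 - E r ^ 2)) atTop
      (𝓝 (r₀ ^ (k + 2) - μ)) := by
  have hk1 : Tendsto (fun r => (k : ℝ) + 2 - k * E r) atTop (𝓝 (k + 2 - k * 1)) :=
    (hE.const_mul (k : ℝ)).const_sub ((k : ℝ) + 2)
  have hk0 : (0 : ℝ) < k + 2 - k * 1 := by ring_nf; norm_num
  have h1 := h.mul ((((hv.div hE one_ne_zero).pow (k + 2)).div (tendsto_torusDensity (k := k) hv hw)
    one_ne_zero).mul (((hE.const_add 1).mul (hE.const_mul 2)).div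
      hk1 hk0.ne'))
  have hval : (r₀ ^ (k + 2) - μ) / 2 * ((1 / 1) ^ (k + 2) / 1 *
      ((1 + 1) * (2 * 1) / (k + 2 - k * 1))) = r₀ ^ (k + 2) - μ := by
    simp only [div_one, one_pow]; ring_nf
  rw [hval] at h1
  refine h1.congr' ?_
  filter_upwards [hEH, hE.eventually (lt_mem_nhds one_pos), hk1.eventually (lt_mem_nhds hk0),
    eventually_gt_atTop 0] with r h2 h3 h4 hr
  have hA : 0 < torusDensity k v w r := Real.exp_pos _
  have h5 : H r - (k + 1) = (1 - E r) * (k + 2 - k * E r) / (2 * E r) := by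
    field_simp; linarith
  simp only [Pi.div_apply]
  rw [h5]
  have h6 : (k : ℝ) + 2 - k * E r ≠ 0 := h4.ne'
  simp only [div_pow]
  generalize (k : ℝ) + 2 - k * E r = D at h6
  field_simp
  ring

theorem tendsto_meanCurv {k : ℕ} {ℓ : ℝ} {H v w : ℝ → ℝ}
    (hv : Tendsto (fun r => Real.exp (v r) / r) atTop (𝓝 1))
    (hw : Tendsto (fun r => Real.exp (w r) / r) atTop (𝓝 1))
    (h : Tendsto (fun r => r * torusDensity k v w r * (H r - (k + 1))) atTop (𝓝 ℓ)) :
    Tendsto H atTop (𝓝 (k + 1)) := by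
  have h1 : Tendsto (fun r : ℝ => (r ^ (k + 2))⁻¹) atTop (𝓝 0) :=
    (tendsto_pow_atTop (by simp)).inv_tendsto_atTop
  have h2 := ((h.mul h1).div (tendsto_torusDensity (k := k) hv hw) one_ne_zero).add_const ((k : ℝ) + 1)
  simp only [mul_zero, zero_div, zero_add] at h2
  refine h2.congr' ?_
  filter_upwards [eventually_gt_atTop 0] with r hr
  have hA : 0 < torusDensity k v w r := Real.exp_pos _
  simp only [Pi.div_apply]
  field_simp
  ring

/-- It follows from S ≤ H; the bound is the quantity whose limit at the core is r₀. -/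
theorem comparisonRadius_le {k : ℕ} {u v w : ℝ → ℝ} {r : ℝ}
    (hH : (k : ℝ) + 1 < meanCurv k u v w r) :
    comparisonRadius k u v w r ≤ Real.exp (v r) * meanCurv k u v w r * (2 / (k + 2)) := by
  have hk : (0 : ℝ) ≤ k := Nat.cast_nonneg k
  have hS : hmRoot k (meanCurv k u v w r) ≤ meanCurv k u v w r := by
    refine (Real.sqrt_le_sqrt (y := meanCurv k u v w r ^ 2) ?_).trans_eq
      (Real.sqrt_sq (by linarith))
    nlinarith
  rw [comparisonRadius, hmParam, div_div_eq_mul_div, mul_assoc, mul_div_assoc]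
  refine mul_le_mul_of_nonneg_left ?_ (Real.exp_pos _).le
  rw [mul_div_assoc', div_le_div_iff_of_pos_right (by positivity)]
  linarith

theorem tendsto_comparisonRadius_bound {k : ℕ} {r₀ : ℝ} {u v w : ℝ → ℝ}
    (hcore : Tendsto (fun r => Real.exp (v r) * meanCurv k u v w r) (𝓝[>] r₀)
      (𝓝 (((k : ℝ) + 2) * r₀ / 2))) :
    Tendsto (fun r => Real.exp (v r) * meanCurv k u v w r * (2 / (k + 2))) (𝓝[>] r₀)
      (𝓝 r₀) := by
  have h := hcore.mul_const (2 / ((k : ℝ) + 2))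
  rwa [show ((k : ℝ) + 2) * r₀ / 2 * (2 / (k + 2)) = r₀ by
    have : (k : ℝ) + 2 ≠ 0 := by positivity
    field_simp] at h

/-! ### Monotonicity of the comparison mass and its bound at the core. -/

theorem antitoneOn_comparisonMass {k : ℕ} {r₀ : ℝ} {u v w : ℝ → ℝ}
    (hu : ContDiffOn ℝ ∞ u (Set.Ioi r₀)) (hv : ContDiffOn ℝ ∞ v (Set.Ioi r₀))
    (hw : ContDiffOn ℝ ∞ w (Set.Ioi r₀))
    (hR : ∀ r, r₀ < r → 2 * radialDeriv u (meanCurv k u v w) r ≤ ((k : ℝ) + 2) * (k + 1)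
      - meanCurv k u v w r ^ 2 - radialDeriv u v r ^ 2 - k * radialDeriv u w r ^ 2)
    (hH : ∀ r, r₀ < r → (k : ℝ) + 1 < meanCurv k u v w r) :
    AntitoneOn (comparisonMass k u v w) (Set.Ioi r₀) := by
  have hd : ∀ r, r₀ < r → HasDerivAt (comparisonMass k u v w) _ r := fun r hr =>
    hasDerivAt_comparisonMass hu hv hw hr (hH r hr)
  apply antitoneOn_of_deriv_nonpos (convex_Ioi r₀)
  · exact fun r hr => (hd r hr).continuousAt.continuousWithinAt
  · intro r hr
    rw [interior_Ioi] at hr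
    exact (hd r hr).differentiableAt.differentiableWithinAt
  · intro r hr
    rw [interior_Ioi] at hr
    have hr' : r₀ < r := hr
    have hE := hmParam_pos (hH r hr')
    rw [(hd r hr').deriv]
    refine mul_nonpos_of_nonneg_of_nonpos ?_ ?_
    · have : 0 < comparisonRadius k u v w r := div_pos (Real.exp_pos _) hE
      positivity
    · refine (comparisonMass_bracket_le (hH r hr') rfl (hR r hr')).trans ?_
      rw [neg_nonpos]
      positivity

theorem comparisonMass_le {k : ℕ} {r₀ : ℝ} {u v w : ℝ → ℝ}
    (hanti : AntitoneOn (comparisonMass k u v w) (Set.Ioi r₀))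
    (hH : ∀ r, r₀ < r → (k : ℝ) + 1 < meanCurv k u v w r)
    (hcore : Tendsto (fun r => Real.exp (v r) * meanCurv k u v w r) (𝓝[>] r₀)
      (𝓝 (((k : ℝ) + 2) * r₀ / 2))) {r : ℝ} (hr : r₀ < r) :
    comparisonMass k u v w r ≤ r₀ ^ (k + 2) := by
  -- For s close to r₀, M(r) ≤ M(s) ≤ c(s)^(k+2), and c(s) is at most a quantity tending to r₀; the
  -- limit of E at the core is not needed.
  refine ge_of_tendsto ((tendsto_comparisonRadius_bound hcore).pow (k + 2)) ?_
  filter_upwards [Ioc_mem_nhdsGT hr] with s hs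
  have hs0 : r₀ < s := hs.1
  refine (hanti hs0 hr hs.2).trans ?_
  have hE := hmParam_pos (hH s hs0)
  have hc : 0 < comparisonRadius k u v w s := div_pos (Real.exp_pos _) hE
  have h1 : comparisonMass k u v w s ≤ comparisonRadius k u v w s ^ (k + 2) := by
    refine mul_le_of_le_one_right (by positivity) ?_
    nlinarith
  exact h1.trans (pow_le_pow_left₀ hc.le (comparisonRadius_le (hH s hs0)) _)

/-! ### Rigidity. -/

theorem pullback_radial (k : ℕ) (r₀ : ℝ) (ψ : ℝ → ℝ) (q : Fin (k + 2) → ℝ) :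
    pullback (fun p => Function.update p 0 (ψ (p 0))) (hmMetric k r₀) q
      = Matrix.diagonal fun i => if i = 0 then deriv ψ (q 0) ^ 2 / hmF k r₀ (ψ (q 0))
          else if i = 1 then hmF k r₀ (ψ (q 0)) else ψ (q 0) ^ 2 := by
  have hpd : ∀ i a : Fin (k + 2), pd i (fun p => Function.update p 0 (ψ (p 0)) a) q
      = if a = i then (if i = 0 then deriv ψ (q 0) else 1) else 0 := by
    intro i a
    by_cases ha : a = 0
    · subst ha
      simp only [Function.update_self]
      rw [pd_comp_zero]
      by_cases hi : i = 0
      · simp [hi]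
      · simp [hi, Ne.symm hi]
    · unfold pd
      simp only [Function.update_of_ne ha]
      by_cases hi : a = i
      · subst hi; simp [ha]
      · simp [hi]
  ext i j
  simp only [pullback, Matrix.of_apply, hpd]
  rw [Finset.sum_eq_single i, Finset.sum_eq_single j]
  · simp only [if_true]
    have h1 : (1 : Fin (k + 2)) ≠ 0 := by simp
    by_cases hij : i = j
    · subst hij
      simp only [hmMetric, Matrix.diagonal_apply_eq, Function.update_self]
      by_cases hi : i = 0
      · simp [hi]; ring
      · simp [hi]
    · simp [hmMetric, hij]
  · intro b _ hb; simp [hb]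
  · simp
  · intro a _ ha; simp [ha]
  · simp

theorem coincidesWithHM_iff {k : ℕ} {r₀ : ℝ} {u v w : ℝ → ℝ} :
    CoincidesWithHM k r₀ (warpedMetric k u v w) ↔
      ∃ ψ : ℝ → ℝ, ContDiffOn ℝ ∞ ψ (Set.Ioi r₀) ∧ (∀ r, r₀ < r → 0 < deriv ψ r) ∧
        Set.BijOn ψ (Set.Ioi r₀) (Set.Ioi r₀) ∧ ∀ r, r₀ < r →
          Real.exp (2 * u r) = deriv ψ r ^ 2 / hmF k r₀ (ψ r) ∧
          Real.exp (2 * v r) = hmF k r₀ (ψ r) ∧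
          (k ≠ 0 → Real.exp (2 * w r) = ψ r ^ 2) := by
  refine exists_congr fun ψ => and_congr_right fun _ => and_congr_right fun _ =>
    and_congr_right fun _ => ⟨fun h r hr => ?_, fun h q hq => ?_⟩
  · have h1 := h (fun _ => r) hr
    rw [pullback_radial] at h1
    have h2 := fun i => congrFun (congrFun h1 i) i
    simp only [warpedMetric, Matrix.diagonal_apply_eq] at h2
    refine ⟨by simpa using h2 0, by simpa using h2 1, fun hk => ?_⟩
    have := h2 ⟨2, by omega⟩
    simpa [Fin.ext_iff] using this
  · rw [pullback_radial, warpedMetric]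
    congr 1
    funext i
    by_cases h0 : i = 0
    · simp only [h0, if_true]; exact (h _ hq).1
    · by_cases h1 : i = 1
      · simp only [h1, if_true]; simpa using (h _ hq).2.1
      · simp only [h0, h1, if_false]
        refine (h _ hq).2.2 fun hk => ?_
        subst hk
        fin_cases i <;> simp at h0 h1

/-- The structure equations of a metric on which the comparison mass is constant. -/
theorem rigidity_equations {k : ℕ} {r₀ : ℝ} {u v w : ℝ → ℝ}
    (hu : ContDiffOn ℝ ∞ u (Set.Ioi r₀)) (hv : ContDiffOn ℝ ∞ v (Set.Ioi r₀))
    (hw : ContDiffOn ℝ ∞ w (Set.Ioi r₀))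
    (hR : ∀ r, r₀ < r → 2 * radialDeriv u (meanCurv k u v w) r ≤ ((k : ℝ) + 2) * (k + 1)
      - meanCurv k u v w r ^ 2 - radialDeriv u v r ^ 2 - k * radialDeriv u w r ^ 2)
    (hH : ∀ r, r₀ < r → (k : ℝ) + 1 < meanCurv k u v w r) {m₀ : ℝ}
    (hconst : ∀ r, r₀ < r → comparisonMass k u v w r = m₀) {r : ℝ} (hr : r₀ < r) :
    (k ≠ 0 → radialDeriv u w r = hmParam k (meanCurv k u v w r)) ∧
      HasDerivAt (comparisonRadius k u v w) (Real.exp (u r) * Real.exp (v r)) r := by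
  have hHr := hH r hr
  have hE := hmParam_pos hHr
  have hS := zero_lt_one.trans (one_lt_hmRoot hHr)
  have hEH := meanCurv_eq_hmParam hHr
  have hES := hmRoot_eq_hmParam hHr
  have hc : 0 < comparisonRadius k u v w r := div_pos (Real.exp_pos _) hE
  have hcv : Real.exp (v r) = comparisonRadius k u v w r * hmParam k (meanCurv k u v w r) := by
    rw [comparisonRadius, div_mul_cancel₀ _ hE.ne']
  have h0 : HasDerivAt (comparisonMass k u v w) 0 r := by
    refine (hasDerivAt_const r m₀).congr_of_eventuallyEq ?_
    filter_upwards [Ioi_mem_nhds hr] with s hs using hconst s hs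
  have h1 := (hasDerivAt_comparisonMass hu hv hw hr hHr).unique h0
  have h2 := (mul_eq_zero.1 h1).resolve_left (by positivity)
  have h3 := comparisonMass_bracket_le hHr rfl (hR r hr)
  rw [h2] at h3
  have hd := hasDerivAt_comparisonRadius hu hv hw hr hHr
  have hHpq : meanCurv k u v w r = radialDeriv u v r + k * radialDeriv u w r := rfl
  rw [hcv]
  generalize meanCurv k u v w r = H at *
  generalize radialDeriv u (meanCurv k u v w) r = h at *
  generalize hmParam k H = E at *
  generalize hmRoot k H = S at *
  generalize radialDeriv u v r = p at *
  generalize radialDeriv u w r = q at *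
  -- The factor k is kept so that k = 0, where q carries no information, is covered by the same
  -- computation of p.
  have hkE : (k : ℝ) * (E - q) = 0 := by
    have h4 : (k : ℝ) * (k + 1) * (E - q) ^ 2 = 0 := by
      refine le_antisymm ?_ (by positivity)
      by_contra! hlt
      have := mul_pos hE hlt
      linarith
    rcases mul_eq_zero.1 h4 with h5 | h5
    · have : (k : ℝ) = 0 := (mul_eq_zero.1 h5).resolve_right (by positivity)
      rw [this, zero_mul]
    · rw [pow_eq_zero_iff two_ne_zero] at h5
      rw [h5, mul_zero]
  refine ⟨fun hk => ?_, hd.congr_deriv ?_⟩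
  · have := (mul_eq_zero.1 hkE).resolve_left (Nat.cast_ne_zero.2 hk)
    linarith
  · have hp : p = S := by
      have : 2 * E * (p - S) = 0 := by
        linear_combination hEH - hES - 2 * E * hHpq + 2 * E * hkE
      have := (mul_eq_zero.1 this).resolve_left (by positivity)
      linarith
    have : p + h / S = E := by
      rw [hp] at h2 ⊢
      field_simp
      have : 2 * E * (S ^ 2 + h - S * E) = 0 := by
        linear_combination S * hES + h2
      have := (mul_eq_zero.1 this).resolve_left (by positivity)
      linarith
    rw [this]
    ring

/-- The new radial coordinate ψ is the comparison radius. Constancy of the comparison mass gives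
f(ψ) = e^{2v}, and dψ/dr = e^{u+v} then gives the radial component. -/
theorem coincidesWithHM_of_const {k : ℕ} {r₀ : ℝ} {u v w : ℝ → ℝ}
    (hu : ContDiffOn ℝ ∞ u (Set.Ioi r₀)) (hv : ContDiffOn ℝ ∞ v (Set.Ioi r₀))
    (hw : ContDiffOn ℝ ∞ w (Set.Ioi r₀))
    (hR : ∀ r, r₀ < r → 2 * radialDeriv u (meanCurv k u v w) r ≤ ((k : ℝ) + 2) * (k + 1)
      - meanCurv k u v w r ^ 2 - radialDeriv u v r ^ 2 - k * radialDeriv u w r ^ 2)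
    (hH : ∀ r, r₀ < r → (k : ℝ) + 1 < meanCurv k u v w r)
    (hconst : ∀ r, r₀ < r → comparisonMass k u v w r = r₀ ^ (k + 2))
    (hcore : Tendsto (fun r => Real.exp (v r) * meanCurv k u v w r) (𝓝[>] r₀)
      (𝓝 (((k : ℝ) + 2) * r₀ / 2)))
    (hvlim : Tendsto (fun r => Real.exp (v r) / r) atTop (𝓝 1))
    (hwlim : Tendsto (fun r => Real.exp (w r) / r) atTop (𝓝 1))
    (hE : Tendsto (fun r => hmParam k (meanCurv k u v w r)) atTop (𝓝 1)) :
    CoincidesWithHM k r₀ (warpedMetric k u v w) := by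
  set ψ := comparisonRadius k u v w with hψ
  have hd : ∀ r, r₀ < r → HasDerivAt ψ (Real.exp (u r) * Real.exp (v r)) r := fun r hr =>
    (rigidity_equations hu hv hw hR hH hconst hr).2
  have hψpos : ∀ r, r₀ < r → 0 < ψ r := fun r hr =>
    div_pos (Real.exp_pos _) (hmParam_pos (hH r hr))
  have hψE : ∀ r, r₀ < r → Real.exp (v r) = ψ r * hmParam k (meanCurv k u v w r) :=
    fun r hr => (div_mul_cancel₀ _ (hmParam_pos (hH r hr)).ne').symm
  have hψlim : Tendsto (fun r => ψ r / r) atTop (𝓝 1) := by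
    have := hvlim.div hE one_ne_zero
    rw [div_one] at this
    refine this.congr fun r => ?_
    simp only [Pi.div_apply, hψ, comparisonRadius]
    ring
  have hψtop : Tendsto ψ atTop atTop := by
    have := hψlim.pos_mul_atTop one_pos tendsto_id
    refine this.congr' ?_
    filter_upwards [eventually_gt_atTop 0] with r hr
    simp only [id]
    field_simp
  have hratio : ∀ r, r₀ < r →
      (r₀ / ψ r) ^ (k + 2) = 1 - hmParam k (meanCurv k u v w r) ^ 2 := by
    intro r hr
    have := pow_ne_zero (k + 2) (hψpos r hr).ne'
    rw [div_pow, ← hconst r hr, comparisonMass, mul_div_cancel_left₀ _ this]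
  have hF : ∀ r, r₀ < r → hmF k r₀ (ψ r) = Real.exp (v r) ^ 2 := by
    intro r hr
    rw [hmF, hratio r hr, hψE r hr]
    ring
  have hmaps : Set.MapsTo ψ (Set.Ioi r₀) (Set.Ioi r₀) := by
    intro r hr
    have h1 : (r₀ / ψ r) ^ (k + 2) < 1 := by
      rw [hratio r hr]
      have := hmParam_pos (hH r hr)
      nlinarith
    have h2 := lt_of_pow_lt_pow_left₀ (k + 2) zero_le_one (h1.trans_eq (one_pow _).symm)
    exact (div_lt_one (hψpos r hr)).1 h2
  have hcont : ContinuousOn ψ (Set.Ioi r₀) := fun r hr =>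
    (hd r hr).continuousAt.continuousWithinAt
  have hderiv : ∀ r, r₀ < r → 0 < deriv ψ r := fun r hr => by
    rw [(hd r hr).deriv]; positivity
  have hmono : StrictMonoOn ψ (Set.Ioi r₀) :=
    strictMonoOn_of_deriv_pos (convex_Ioi r₀) hcont fun r hr => by
      rw [interior_Ioi] at hr; exact hderiv r hr
  have hsurj : Set.SurjOn ψ (Set.Ioi r₀) (Set.Ioi r₀) := by
    intro y hy
    obtain ⟨b, hb0, hby⟩ := ((eventually_gt_atTop r₀).and
      (hψtop.eventually (eventually_ge_atTop y))).exists
    -- Since ψ is bounded above by a function tending to r₀ < y at the core, it takes a value ≤ y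
    -- there; the intermediate value theorem applies because ψ tends to infinity.
    have h1 := (tendsto_comparisonRadius_bound hcore).eventually (gt_mem_nhds hy)
    obtain ⟨a, ha, ha0, hab⟩ := (h1.and (Ioc_mem_nhdsGT hb0)).exists
    have hay : ψ a ≤ y := (comparisonRadius_le (hH a ha0)).trans ha.le
    obtain ⟨c, hc, hcy⟩ := intermediate_value_Icc hab
      (hcont.mono fun x hx => ha0.trans_le hx.1) ⟨hay, hby⟩
    exact ⟨c, ha0.trans_le hc.1, hcy⟩
  have hsmooth : ContDiffOn ℝ ∞ ψ (Set.Ioi r₀) := by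
    have hHs : ContDiffOn ℝ ∞ (meanCurv k u v w) (Set.Ioi r₀) :=
      (hu.neg.exp.mul (contDiffOn_deriv_Ioi hv)).add
        (contDiffOn_const.mul (hu.neg.exp.mul (contDiffOn_deriv_Ioi hw)))
    have hSs : ContDiffOn ℝ ∞ (fun r => hmRoot k (meanCurv k u v w r)) (Set.Ioi r₀) :=
      ((hHs.pow 2).sub contDiffOn_const).sqrt fun r hr =>
        (zero_lt_one.trans (one_lt_radicand (hH r hr))).ne'
    have hk : (0 : ℝ) ≤ k := Nat.cast_nonneg k
    refine hv.exp.div (contDiffOn_const.div (hHs.add hSs) fun r hr => ?_)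
      fun r hr => (hmParam_pos (hH r hr)).ne'
    have h1 := one_lt_hmRoot (hH r hr)
    have h2 := hH r hr
    exact (by linarith : 0 < meanCurv k u v w r + hmRoot k (meanCurv k u v w r)).ne'
  refine coincidesWithHM_iff.2 ⟨ψ, hsmooth, hderiv, ⟨hmaps, hmono.injOn, hsurj⟩,
    fun r hr => ⟨?_, ?_, fun hk => ?_⟩⟩
  · rw [hF r hr, (hd r hr).deriv, exp_two_mul_eq_sq]
    field_simp
  · rw [hF r hr, exp_two_mul_eq_sq]
  -- Both w and log ψ have r-derivative e^u E, so e^w/ψ is constant; the asymptotics make the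
  -- constant 1.
  · have hq : ∀ s, r₀ < s → HasDerivAt (fun s => Real.exp (w s) / ψ s) 0 s := by
      intro s hs
      have h1 := (rigidity_equations hu hv hw hR hH hconst hs).1 hk
      have h2 : deriv w s = Real.exp (u s) * hmParam k (meanCurv k u v w s) := by
        rw [← h1, radialDeriv, ← mul_assoc, ← Real.exp_add, add_neg_cancel, Real.exp_zero,
          one_mul]
      refine ((hasDerivAt_of_contDiffOn hw hs).exp.div (hd s hs)
        (hψpos s hs).ne').congr_deriv ?_
      rw [h2, hψE s hs]
      field_simp
      ring
    have hc : ∀ s, r₀ < s → Real.exp (w s) / ψ s = Real.exp (w r) / ψ r := fun s hs =>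
      isOpen_Ioi.is_const_of_deriv_eq_zero isPreconnected_Ioi
        (fun t ht => (hq t ht).differentiableAt.differentiableWithinAt)
        (fun t ht => (hq t ht).deriv) hs hr
    have hl : Tendsto (fun s => Real.exp (w s) / ψ s) atTop (𝓝 1) := by
      have := hwlim.div hψlim one_ne_zero
      rw [div_one] at this
      refine this.congr' ?_
      filter_upwards [eventually_gt_atTop 0] with s hs
      simp only [Pi.div_apply]
      rw [div_div_div_cancel_right₀ hs.ne']
    have hl' : Tendsto (fun s => Real.exp (w s) / ψ s) atTop (𝓝 (Real.exp (w r) / ψ r)) := by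
      refine tendsto_const_nhds.congr' ?_
      filter_upwards [eventually_gt_atTop r₀] with s hs using (hc s hs).symm
    have h1 := tendsto_nhds_unique hl' hl
    rw [div_eq_one_iff_eq (hψpos r hr).ne'] at h1
    rw [exp_two_mul_eq_sq, h1]

/-- The mean curvature of the tori in a reparametrized Horowitz-Myers metric. -/
theorem meanCurv_of_coincides {k : ℕ} {r₀ : ℝ} (hr₀ : 0 < r₀) {u v w ψ : ℝ → ℝ}
    (hv : ContDiffOn ℝ ∞ v (Set.Ioi r₀)) (hw : ContDiffOn ℝ ∞ w (Set.Ioi r₀))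
    (hψ : ContDiffOn ℝ ∞ ψ (Set.Ioi r₀)) (hψ' : ∀ r, r₀ < r → 0 < deriv ψ r)
    (hmaps : Set.MapsTo ψ (Set.Ioi r₀) (Set.Ioi r₀))
    (h : ∀ r, r₀ < r → Real.exp (2 * u r) = deriv ψ r ^ 2 / hmF k r₀ (ψ r) ∧
          Real.exp (2 * v r) = hmF k r₀ (ψ r) ∧
          (k ≠ 0 → Real.exp (2 * w r) = ψ r ^ 2)) {r : ℝ} (hr : r₀ < r) :
    Real.exp (v r) = ψ r * Real.sqrt (1 - (r₀ / ψ r) ^ (k + 2)) ∧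
    2 * Real.sqrt (1 - (r₀ / ψ r) ^ (k + 2)) * meanCurv k u v w r
      = k + 2 + k * Real.sqrt (1 - (r₀ / ψ r) ^ (k + 2)) ^ 2 := by
  have hψr : r₀ < ψ r := hmaps hr
  have hψ0 := hr₀.trans hψr
  have hX1 : 0 < 1 - (r₀ / ψ r) ^ (k + 2) := sub_pos.2 (pow_ratio_lt_one hr₀ hψr)
  have hd := hasDerivAt_of_contDiffOn hψ hr
  have hev : Real.exp (v r) = ψ r * Real.sqrt (1 - (r₀ / ψ r) ^ (k + 2)) := by
    rw [← Real.sqrt_sq (Real.exp_pos (v r)).le, ← exp_two_mul_eq_sq, (h r hr).2.1, hmF,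
      Real.sqrt_mul (by positivity), Real.sqrt_sq hψ0.le]
  have heu : Real.exp (u r) * Real.exp (v r) = deriv ψ r := by
    have h1 : (Real.exp (u r) * Real.exp (v r)) ^ 2 = deriv ψ r ^ 2 := by
      rw [mul_pow, ← exp_two_mul_eq_sq, ← exp_two_mul_eq_sq, (h r hr).1, (h r hr).2.1,
        div_mul_cancel₀ _ (hmF_pos hr₀ hψr).ne']
    exact (pow_left_inj₀ (by positivity) (hψ' r hr).le two_ne_zero).1 h1
  refine ⟨hev, ?_⟩
  have hv' : 2 * Real.exp (v r) ^ 2 * deriv v r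
      = (2 * ψ r * (1 - (r₀ / ψ r) ^ (k + 2)) + (k + 2) * ψ r * (r₀ / ψ r) ^ (k + 2))
        * deriv ψ r := by
    have h1 := ((hasDerivAt_of_contDiffOn hv hr).const_mul 2).exp
    have h2 := (hasDerivAt_hmF k r₀ hψ0).comp r hd
    have h3 : (fun r => Real.exp (2 * v r)) =ᶠ[𝓝 r] (hmF k r₀ ∘ ψ) := by
      filter_upwards [Ioi_mem_nhds hr] with s hs using (h s hs).2.1
    have h4 := h1.unique (h2.congr_of_eventuallyEq h3)
    rw [exp_two_mul_eq_sq] at h4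
    linarith
  have hw' : (k : ℝ) * (ψ r * deriv w r) = k * deriv ψ r := by
    by_cases hk : k = 0
    · simp [hk]
    · have h1 := ((hasDerivAt_of_contDiffOn hw hr).const_mul 2).exp
      have h2 := hd.pow 2
      have h3 : (fun r => Real.exp (2 * w r)) =ᶠ[𝓝 r] (ψ ^ 2) := by
        filter_upwards [Ioi_mem_nhds hr] with s hs using (h s hs).2.2 hk
      have h4 := h1.unique (h2.congr_of_eventuallyEq h3)
      rw [(h r hr).2.2 hk] at h4
      have h5 : 2 * ψ r * (ψ r * deriv w r) = 2 * ψ r * deriv ψ r := by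
        simp only [Nat.cast_ofNat, Nat.add_one_sub_one, pow_one] at h4
        linarith
      rw [mul_left_cancel₀ (by positivity) h5]
  have hS := Real.sqrt_pos.2 hX1
  have hS2 := Real.sq_sqrt hX1.le
  rw [meanCurv, radialDeriv, radialDeriv, Real.exp_neg]
  rw [← heu, hev] at hv' hw'
  generalize Real.sqrt (1 - (r₀ / ψ r) ^ (k + 2)) = S at *
  generalize (r₀ / ψ r) ^ (k + 2) = X at *
  have hX : X = 1 - S ^ 2 := by linarith
  subst hX
  have a1 := Real.exp_pos (u r)
  have hv2 : 2 * deriv v r * S = Real.exp (u r) * (2 * S ^ 2 + (k + 2) * (1 - S ^ 2)) := by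
    have : ψ r ^ 2 * S * (2 * deriv v r * S)
        = ψ r ^ 2 * S * (Real.exp (u r) * (2 * S ^ 2 + (k + 2) * (1 - S ^ 2))) := by
      linear_combination hv'
    exact mul_left_cancel₀ (by positivity) this
  have hw2 : (k : ℝ) * deriv w r = k * (Real.exp (u r) * S) := by
    have : ψ r * (k * deriv w r) = ψ r * (k * (Real.exp (u r) * S)) := by
      linear_combination hw'
    exact mul_left_cancel₀ hψ0.ne' this
  field_simp
  linear_combination hv2 + 2 * S * hw2

/-- With E = √f(ψ)/ψ one has e^v/E = ψ, so ψ^(k+2)(1 - E²) is identically r₀^(k+2), while its limit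
is r₀^(k+2) - μ. -/
theorem mass_of_coincides {k : ℕ} {r₀ μ : ℝ} (hr₀ : 0 < r₀) {u v w : ℝ → ℝ}
    (hv : ContDiffOn ℝ ∞ v (Set.Ioi r₀)) (hw : ContDiffOn ℝ ∞ w (Set.Ioi r₀))
    (hvlim : Tendsto (fun r => Real.exp (v r) / r) atTop (𝓝 1))
    (hwlim : Tendsto (fun r => Real.exp (w r) / r) atTop (𝓝 1))
    (hμ : Tendsto (fun r => r * torusDensity k v w r * (meanCurv k u v w r - (k + 1))) atTop
      (𝓝 ((r₀ ^ (k + 2) - μ) / 2)))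
    (h : CoincidesWithHM k r₀ (warpedMetric k u v w)) : μ = 0 := by
  obtain ⟨ψ, hψ, hψ', hbij, heq⟩ := coincidesWithHM_iff.1 h
  have hm := fun r (hr : r₀ < r) => meanCurv_of_coincides hr₀ hv hw hψ hψ' hbij.mapsTo heq hr
  have hpos : ∀ r, r₀ < r → 0 < 1 - (r₀ / ψ r) ^ (k + 2) := fun r hr =>
    sub_pos.2 (pow_ratio_lt_one hr₀ (hbij.mapsTo hr))
  have hvtop : Tendsto (fun r => Real.exp (v r)) atTop atTop := by
    refine (hvlim.pos_mul_atTop one_pos tendsto_id).congr' ?_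
    filter_upwards [eventually_gt_atTop 0] with r hr
    simp only [id]
    field_simp
  have hψtop : Tendsto ψ atTop atTop := by
    refine tendsto_atTop_mono' _ ?_ hvtop
    filter_upwards [eventually_gt_atTop r₀] with r hr
    have hψ0 : 0 < ψ r := hr₀.trans (hbij.mapsTo hr)
    rw [(hm r hr).1]
    refine mul_le_of_le_one_right hψ0.le (Real.sqrt_le_one.2 ?_)
    have : 0 ≤ (r₀ / ψ r) ^ (k + 2) := by positivity
    linarith
  have hE := (tendsto_sqrt_one_sub k r₀).comp hψtop
  have hlim := tendsto_comparisonMass (H := meanCurv k u v w) hvlim hwlim hE (by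
    filter_upwards [eventually_gt_atTop r₀] with r hr using (hm r hr).2) hμ
  have hconst : Tendsto (fun _ : ℝ => r₀ ^ (k + 2)) atTop (𝓝 (r₀ ^ (k + 2) - μ)) := by
    refine hlim.congr' ?_
    filter_upwards [eventually_gt_atTop r₀] with r hr
    have hψ0 : 0 < ψ r := hr₀.trans (hbij.mapsTo hr)
    have hS := Real.sqrt_pos.2 (hpos r hr)
    simp only [Function.comp_apply]
    rw [(hm r hr).1, mul_div_cancel_right₀ _ hS.ne', Real.sq_sqrt (hpos r hr).le, sub_sub_cancel,
      ← mul_pow, mul_div_cancel₀ _ hψ0.ne']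
  have := tendsto_nhds_unique tendsto_const_nhds hconst
  linarith

/-! ### Conclusion. -/

theorem massDensity_limit {k : ℕ} {r₀ μ : ℝ} (hr₀ : 0 < r₀) {u v w : ℝ → ℝ}
    (hu : ContDiffOn ℝ ∞ u (Set.Ioi r₀)) (hv : ContDiffOn ℝ ∞ v (Set.Ioi r₀))
    (hw : ContDiffOn ℝ ∞ w (Set.Ioi r₀))
    (hM : IsSmoothMetricOnBulk k r₀ (warpedMetric k u v w))
    (hx : IsFastToOne k fun r => Real.exp (2 * u r) / (1 / hmF k r₀ r))
    (hy : IsFastToOne k fun r => Real.exp (2 * v r) / hmF k r₀ r)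
    (hz : IsFastToOne k fun r => Real.exp (2 * w r) / r ^ 2)
    (hR : ∀ q : Fin (k + 2) → ℝ, r₀ < q 0 →
      -(((k + 2 : ℕ) : ℝ) * (((k + 2 : ℕ) : ℝ) - 1)) ≤
        scalarCurvature (warpedMetric k u v w) q)
    (hμ : Tendsto (massDensity k r₀ u v w) atTop (𝓝 μ)) :
    0 ≤ μ ∧ (μ = 0 ↔ CoincidesWithHM k r₀ (warpedMetric k u v w)) := by
  have hvlim := tendsto_exp_v_div hr₀ hy
  have hwlim := tendsto_exp_w_div hz
  have hdef := tendsto_meanCurv_defect hr₀ hx hy hz hμ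
  have hcore := (tendsto_core hr₀ hv hw hM).2
  have hR' : ∀ r, r₀ < r → _ := fun r hr => radialDeriv_meanCurv_le hu hv hw hR hr
  have hE : Tendsto (fun r => hmParam k (meanCurv k u v w r)) atTop (𝓝 1) :=
    (continuousAt_hmParam k).comp (tendsto_meanCurv hvlim hwlim hdef)
  -- The sign of μ serves only to make the limiting defect (r₀^(k+2) - μ)/2 positive, hence H > k +
  -- 1 near infinity. The case μ < 0 is then contradictory, and μ = 0 pins the comparison mass to
  -- r₀^(k+2).
  have key : μ ≤ 0 → (∀ r, r₀ < r → (k : ℝ) + 1 < meanCurv k u v w r) ∧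
      ∀ r, r₀ < r → r₀ ^ (k + 2) - μ ≤ comparisonMass k u v w r ∧
        comparisonMass k u v w r ≤ r₀ ^ (k + 2) := by
    intro hle
    have hev : ∀ᶠ r in atTop, (k : ℝ) + 1 < meanCurv k u v w r := by
      have hpos : 0 < (r₀ ^ (k + 2) - μ) / 2 := by
        have := pow_pos hr₀ (k + 2)
        linarith
      filter_upwards [hdef.eventually (lt_mem_nhds hpos), eventually_gt_atTop 0] with r hr hr0
      have hA : 0 < r * torusDensity k v w r := mul_pos hr0 (Real.exp_pos _)
      have := (pos_iff_pos_of_mul_pos hr).1 hA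
      linarith
    have hH : ∀ r, r₀ < r → (k : ℝ) + 1 < meanCurv k u v w r := fun r hr =>
      lt_meanCurv hu hv hw hR' hev hr
    have hanti := antitoneOn_comparisonMass hu hv hw hR' hH
    refine ⟨hH, fun r hr => ⟨?_, comparisonMass_le hanti hH hcore hr⟩⟩
    have hlim := tendsto_comparisonMass (H := meanCurv k u v w) hvlim hwlim hE (by
      filter_upwards [hev] with r hr using meanCurv_eq_hmParam hr) hdef
    refine le_of_tendsto hlim ?_
    filter_upwards [eventually_ge_atTop r] with s hs
    exact hanti hr (hr.trans_le hs) hs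
  have hnonneg : 0 ≤ μ := by
    by_contra! hlt
    obtain ⟨-, h⟩ := key hlt.le
    have := (h (r₀ + 1) (by linarith)).1.trans (h (r₀ + 1) (by linarith)).2
    linarith
  refine ⟨hnonneg, fun h0 => ?_, fun h => mass_of_coincides hr₀ hv hw hvlim hwlim hdef h⟩
  obtain ⟨hH, h⟩ := key h0.le
  rw [h0, sub_zero] at h
  exact coincidesWithHM_of_const hu hv hw hR' hH
    (fun r hr => le_antisymm (h r hr).2 (h r hr).1) hcore hvlim hwlim hE

theorem warpedMetric_zero (u v w w' : ℝ → ℝ) : warpedMetric 0 u v w = warpedMetric 0 u v w' := by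
  funext q
  unfold warpedMetric
  congr 1
  funext i
  fin_cases i <;> simp

/-- For k = 0 the metric does not see w, so the hypotheses say nothing about its growth; replacing
it by log r supplies the asymptotics that the general argument uses. -/
theorem exists_normalized_warp {k : ℕ} {r₀ : ℝ} (hr₀ : 0 < r₀) {u v w : ℝ → ℝ}
    (hw : ContDiffOn ℝ ∞ w (Set.Ioi r₀))
    (h : IsAsymptoticToHM k r₀ (warpedMetric k u v w)) :
    ∃ w' : ℝ → ℝ, ContDiffOn ℝ ∞ w' (Set.Ioi r₀) ∧
      warpedMetric k u v w = warpedMetric k u v w' ∧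
      IsFastToOne k fun r => Real.exp (2 * w' r) / r ^ 2 := by
  by_cases hk : k = 0
  · subst hk
    refine ⟨Real.log, ?_, warpedMetric_zero u v w _, ?_⟩
    · exact Real.contDiffOn_log.mono fun r hr => (hr₀.trans hr).ne'
    · refine tendsto_const_nhds.congr' ?_
      filter_upwards [eventually_gt_atTop 0] with r hr
      rw [exp_two_mul_eq_sq, Real.exp_log hr, div_self (by positivity), sub_self, mul_zero]
  · refine ⟨w, hw, rfl, ?_⟩
    have := h.isFastToOne hr₀ ⟨2, by omega⟩
    simpa [warpExponent, hmComponent, Fin.ext_iff] using this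

end HorowitzMyers

end

theorem mainTheorem2 (k : ℕ) (r₀ : ℝ) (hr₀ : 0 < r₀) (L : Fin k → ℝ) (hL : ∀ A, 0 < L A)
    (u v w : ℝ → ℝ)
    (hu : ContDiffOn ℝ ∞ u (Set.Ioi r₀)) (hv : ContDiffOn ℝ ∞ v (Set.Ioi r₀))
    (hw : ContDiffOn ℝ ∞ w (Set.Ioi r₀))
    (hM : HorowitzMyers.IsSmoothMetricOnBulk k r₀ (HorowitzMyers.warpedMetric k u v w))
    (hasymp : HorowitzMyers.IsAsymptoticToHM k r₀ (HorowitzMyers.warpedMetric k u v w))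
    (hR : ∀ q : Fin (k + 2) → ℝ, r₀ < q 0 →
      -(((k + 2 : ℕ) : ℝ) * (((k + 2 : ℕ) : ℝ) - 1)) ≤
        HorowitzMyers.scalarCurvature (HorowitzMyers.warpedMetric k u v w) q)
    (m : ℝ) (hm : HorowitzMyers.HasMass k r₀ L (HorowitzMyers.warpedMetric k u v w) m) :
    0 ≤ m ∧ (m = 0 ↔ HorowitzMyers.CoincidesWithHM k r₀ (HorowitzMyers.warpedMetric k u v w)) := by
  obtain ⟨w', hw', heq, hz⟩ := HorowitzMyers.exists_normalized_warp hr₀ hw hasymp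
  rw [heq] at hM hasymp hR hm ⊢
  obtain ⟨c, hc, hflux⟩ := HorowitzMyers.massFlux_warpedMetric hr₀ hL
  have hx := hasymp.isFastToOne hr₀ 0
  have hy := hasymp.isFastToOne hr₀ 1
  simp only [HorowitzMyers.warpExponent, HorowitzMyers.hmComponent, if_true, one_ne_zero,
    if_false] at hx hy
  have hμ : Tendsto (HorowitzMyers.massDensity k r₀ u v w') atTop (𝓝 (m / c)) := by
    refine (hm.div_const c).congr' ?_
    filter_upwards [eventually_gt_atTop r₀] with R hR
    rw [hflux u v w' hv hw' R hR, mul_div_cancel_left₀ _ hc.ne']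
  obtain ⟨h1, h2⟩ := HorowitzMyers.massDensity_limit hr₀ hu hv hw' hM hx hy hz hR hμ
  refine ⟨?_, ?_⟩
  · have := mul_nonneg h1 hc.le
    rwa [div_mul_cancel₀ _ hc.ne'] at this
  · rw [← h2, div_eq_zero_iff, or_iff_left hc.ne']
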